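/- **Theorem (Algebraic convergence of the best $s$-term approximation).** Let $\mathcal U=[-1,1]^{\mathbb N}$ with the uniform (product) probability measure $\varrho$. Let $\mathcal F$ be the set of multi-indices $\bm\nu\in\mathbb N_0^{\mathbb N}$ with finitely many nonzero entries and, for $\bm\nu\in\mathcal F$, let $\Psi_{\bm\nu}(\bm y)=\prod_{i:\nu_i\ne 0}\sqrt{2\nu_i+1}\,P_{\nu_i}(y_i)$, where $P_n$ is the Legendre polynomial of degree $n$ with $P_n(1)=1$. Let $\mathcal V$ be a Banach space over $\mathbb R$, regarded as an isometrically embedded real subspace of a complex Banach space $\mathcal W$ (for instance a complexification of $\mathcal V$, or $\mathcal W=\mathcal V$ if $\mathcal V$ is complex). For $\rho\ge 1$ let $\mathcal E(\rho)=\{(z+z^{-1})/2: z\in\mathbb C,\ 1\le|z|\le\rho\}$, and for $\bm b\in[0,\infty)^{\mathbb N}$ let $$\mathcal R(\bm b,1)=\bigcup\Big\{\mathcal E(\rho_1)\times\mathcal E(\rho_2)\times\cdots:\ \rho_j\ge 1\ \ \forall j,\ \ \sum_{j=1}^\infty\Big(\frac{\rho_j+\rho_j^{-1}}2-1\Big)b_j\le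 1\Big\}\subset\mathbb C^{\mathbb N}.$$ Let $\mathcal H(\bm b)$ be the class of all (strongly $\varrho$-measurable) $f:\mathcal U\to\mathcal V$ for which there are a set $\mathcal O\supseteq\mathcal R(\bm b,1)$ that is open in $\mathbb C^{\mathbb N}$ (for the box topology, hence in particular any set open for the product topology) and an extension $\tilde f:\mathcal O\to\mathcal W$ of $f$ that is complex differentiable in each variable at each point of $\mathcal O$ and satisfies $\|\tilde f(\bm z)\|_{\mathcal W}\le 1$ for all $\bm z\in\mathcal R(\bm b,1)$. The Legendre coefficients of $f$ are $\bm c=(c_{\bm\nu})_{\bm\nu\in\mathcal F}$, $c_{\bm\nu}=\int_{\mathcal U}f\,\Psi_{\bm\nu}\,d\varrho\in\mathcal V$. For $S\subset\mathcal F$, $\bm c_S$ is the sequence that agrees with $\bm c$ on $S$ and vanishes off $S$, and $f_S=\sum_{\bm\nu\in S}c_{\bm\nu}\Psi_{\bm\nu}$. Write $\|\bm c\|_{q;\mathcal V}=\big(\sum_{\bm\nu\in\mathcal F}\|c_{\bm\nu}\|_{\mathcal V}^q\big)^{1/q}$ and $\sigma_s(\bm c)_{q;\mathcal V}=\inf\{\|\bm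 c-\bm z\|_{q;\mathcal V}:\bm z\in\ell^q(\mathcal F;\mathcal V),\ |\mathrm{supp}(\bm z)|\le s\}$. Let $\bm b\in[0,\infty)^{\mathbb N}$ with $\bm b\in\ell^p(\mathbb N)$ for some $0<p<1$. Then there is a constant $C=C(\bm b,p)>0$, depending only on $\bm b$ and $p$, with the following properties. 1. For every integer $s\ge 1$ and every $p\le q\le 2$ there is a set $S\subset\mathcal F$ with $|S|\le s$, independent of $\mathcal V$, $\mathcal W$ and $f$, such that for all $f\in\mathcal H(\bm b)$ with Legendre coefficients $\bm c$ $$\sigma_s(\bm c)_{q;\mathcal V}\le\|\bm c-\bm c_S\|_{q;\mathcal V}\le C\, s^{\frac1q-\frac1p}.$$ 2. For every integer $s\ge 1$ there is a set $S\subset\mathcal F$ with $|S|\le s$, independent of $\mathcal V$, $\mathcal W$ and $f$, such that, whenever $\mathcal V$ is a Hilbert space, for all $f\in\mathcal H(\bm b)$ $$\inf_{T\subset\mathcal F,\ |T|=s}\|f-f_T\|_{L^2_\varrho(\mathcal U;\mathcal V)}\le\|f-f_S\|_{L^2_\varrho(\mathcal U;\mathcal V)}\le C\, s^{\frac12-\frac1p}.$$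 -/

import Mathlib

open MeasureTheory Filter Topology
open scoped ENNReal

namespace HoloApprox

noncomputable section

/-- The parameter domain `[-1,1]^ℕ`. -/
abbrev Dom : Type := ℕ → Set.Icc (-1 : ℝ) 1

/-- The uniform probability measure on `[-1,1]`. -/
def unif : Measure (Set.Icc (-1 : ℝ) 1) :=
  (2 : ℝ≥0∞)⁻¹ • Measure.comap Subtype.val (volume : Measure ℝ)

instance : IsProbabilityMeasure unif := by
  constructor
  have h : Measure.comap (Subtype.val : Set.Icc (-1 : ℝ) 1 → ℝ) volume Set.univ = 2 := by
    rw [comap_subtype_coe_apply measurableSet_Icc, Set.image_univ, Subtype.range_coe,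
      Real.volume_Icc]
    norm_num
  simp only [unif, Measure.smul_apply, h, smul_eq_mul]
  exact ENNReal.inv_mul_cancel (by norm_num) (by norm_num)

/-- The uniform (infinite product) probability measure on `[-1,1]^ℕ`. -/
def unifDom : Measure Dom := Measure.infinitePi (fun _ : ℕ => unif)

/-! ### Legendre polynomials and Legendre coefficients -/

/-- The Legendre polynomial of degree `n`, normalized by `P_n(1) = 1` (Rodrigues' formula). -/
def legendreP (n : ℕ) : Polynomial ℝ :=
  Polynomial.C ((2 ^ n * (n.factorial : ℝ))⁻¹) *
    (Polynomial.derivative^[n] ((Polynomial.X ^ 2 - 1) ^ n))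

/-- The univariate Legendre polynomials, orthonormal for the uniform probability measure. -/
def psi (n : ℕ) (t : ℝ) : ℝ := Real.sqrt (2 * (n : ℝ) + 1) * (legendreP n).eval t

/-- The tensor product Legendre polynomials, indexed by the finitely supported multi-indices. -/
def Psi (ν : ℕ →₀ ℕ) (y : Dom) : ℝ := ∏ i ∈ ν.support, psi (ν i) (y i)

section Coefficients

variable {V : Type*} [NormedAddCommGroup V] [NormedSpace ℝ V]

/-- The Legendre coefficients `c_ν = ∫ f Ψ_ν` (Bochner integrals). -/
def coeff (f : Dom → V) (ν : ℕ →₀ ℕ) : V := ∫ y, Psi ν y • f y ∂unifDom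

/-- The truncated expansion `f_S = ∑_{ν ∈ S} c_ν Ψ_ν`. -/
def partialSum (f : Dom → V) (S : Finset (ℕ →₀ ℕ)) (y : Dom) : V :=
  ∑ ν ∈ S, Psi ν y • coeff f ν

/-- The error of best `s`-term polynomial approximation of `f` in the `L²` norm: the infimum of
`‖f - f_S‖` over all index sets `S` of size `s`. -/
def bestL2Error (s : ℕ) (f : Dom → V) : ℝ≥0∞ :=
  ⨅ S ∈ {S : Finset (ℕ →₀ ℕ) | S.card = s},
    eLpNorm (fun y => f y - partialSum f S y) 2 unifDom

end Coefficients

/-! ### Sequence norms -/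

section Sequences

variable {I V : Type*} [NormedAddCommGroup V]

/-- The `ℓ^q` (quasi-)norm of a `V`-valued family, for `0 < q < ∞`. It is `∞` exactly for the
families that are not in `ℓ^q`. -/
def ellNorm (q : ℝ) (c : I → V) : ℝ≥0∞ := (∑' i, ‖c i‖ₑ ^ q) ^ (1 / q)

/-- The restriction `c_S` of a family to an index set, extended by zero. -/
def restr (c : I → V) (S : Finset I) : I → V := Set.indicator (S : Set I) c

/-- The `ℓ^q`-norm best `s`-term approximation error of a family. -/
def bestTermError (s : ℕ) (q : ℝ) (c : I → V) : ℝ≥0∞ :=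
  ⨅ z ∈ {z : I → V | ellNorm q z < ∞ ∧ (Function.support z).encard ≤ s},
    ellNorm q (c - z)

end Sequences

/-! ### Holomorphic functions of infinitely many variables -/

/-- The filled Bernstein ellipse with parameter `ρ ≥ 1`; it is `[-1,1]` for `ρ = 1`. -/
def ellipse (ρ : ℝ) : Set ℂ := {w | ∃ z : ℂ, 1 ≤ ‖z‖ ∧ ‖z‖ ≤ ρ ∧ w = (z + z⁻¹) / 2}

/-- The Bernstein polyellipse with parameter `ρ = (ρ_j)`. -/
def polyellipse (ρ : ℕ → ℝ) : Set (ℕ → ℂ) := {z | ∀ j, z j ∈ ellipse (ρ j)}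

/-- The region `R(b, ε)`, a union of Bernstein polyellipses. -/
def region (b : ℕ → ℝ) (ε : ℝ) : Set (ℕ → ℂ) :=
  {z | ∃ ρ : ℕ → ℝ, (∀ j, 1 ≤ ρ j) ∧
    Summable (fun j => ((ρ j + (ρ j)⁻¹) / 2 - 1) * b j) ∧
    ∑' j, ((ρ j + (ρ j)⁻¹) / 2 - 1) * b j ≤ ε ∧ z ∈ polyellipse ρ}

/-- Openness in `ℂ^ℕ`: with each point, the set contains a product of discs about it (of radii
that may depend on the coordinate). Every set that is open for the product topology, or for
uniform convergence, is open in this sense, so that the class of functions with a holomorphic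
extension is the largest for this choice. -/
def IsBoxOpen (O : Set (ℕ → ℂ)) : Prop :=
  ∀ z ∈ O, ∃ r : ℕ → ℝ, (∀ j, 0 < r j) ∧ ∀ w : ℕ → ℂ, (∀ j, ‖w j - z j‖ < r j) → w ∈ O

/-- Holomorphy in an open set: complex differentiability in each variable at each point, that is,
existence of `lim_{h → 0} (g (z + h e_j) - g z) / h`. The values of `g` off the open set `O` do not
matter. -/
def HolomorphicIn {W : Type*} [NormedAddCommGroup W] [NormedSpace ℂ W]
    (O : Set (ℕ → ℂ)) (g : (ℕ → ℂ) → W) : Prop :=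
  ∀ z ∈ O, ∀ j : ℕ, DifferentiableAt ℂ (fun ζ : ℂ => g (Function.update z j ζ)) (z j)

/-- The class `H(b)` of `(b,1)`-holomorphic functions `f : [-1,1]^ℕ → V` of norm at most one:
`f` extends to a holomorphic function on an open set that contains `R(b,1)`, and the
extension is bounded by one on `R(b,1)`. The complex derivatives of the extension need complex
scalars, so the extension takes values in a complex Banach space `W` that contains the real Banach
space `V` isometrically through `ι`: a complexification of `V`, or `V` itself when `V` is complex
and `ι` is the identity. -/
def holoClass {V W : Type*} [NormedAddCommGroup V] [NormedSpace ℝ V]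
    [NormedAddCommGroup W] [NormedSpace ℂ W] (ι : V →ₗᵢ[ℝ] W) (b : ℕ → ℝ) : Set (Dom → V) :=
  {f | ∃ (O : Set (ℕ → ℂ)) (g : (ℕ → ℂ) → W), IsBoxOpen O ∧ region b 1 ⊆ O ∧
    HolomorphicIn O g ∧
    (∀ y : Dom, g (fun j => (((y j : ℝ) : ℂ))) = ι (f y)) ∧
    ∀ z ∈ region b 1, ‖g z‖ ≤ 1}

end

end HoloApprox

namespace HoloApprox

noncomputable section

/-! ### Legendre polynomials -/

section Legendre

open Polynomial

/-! The theorem follows from a bound `B ν` on the norm of the Legendre coefficient of index `ν` that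
holds for the whole class at once and is `p`-summable. Let `S` consist of `s` indices that include
all those with large `B ν`. Off `S` one has `B ν ^ p ≤ A / s` with `A = 1 + ∑ B ν ^ p`, and
Stechkin's argument (`ellNorm_sub_restr_le`) gives the rate with constant `A ^ (1 / p)`. For
Hilbert-valued functions, density of polynomials and orthonormality bound the `L²` error by the `ℓ²`
norm of the omitted coefficients (`eLpNorm_sub_partialSum_le_ellNorm`).

In one variable, Cauchy's formula on the ellipse of parameter `ρ`, pulled back by the Joukowski map,
expresses a coefficient as an integral over the circle of radius `ρ` against the Legendre transform
of the Cauchy kernel. This kernel is a Chebyshev series in the powers of `w⁻¹`. Its terms of degree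
below `n` are orthogonal to `psi n`, so that the transform is at most `2ρ/(ρ-1) * ρ^(-n)`
(`norm_legendreKernel_le`). In several variables the integration rules are exchanged one coordinate
at a time (`SepHolo.multi_eq`), which needs separate holomorphy only. The coordinates outside the
support of `ν` are frozen and then averaged (`norm_coeff_le`).

The radii may depend on `ν`. A fixed `κ > 1` is used on the support, and from a position `J` on a
term `ν_j / (|n| b_j)` is added, with `n` the tail of `ν`. This respects the budget of the region
(`radii_budget`) and turns the product of the one-variable bounds into finitely many geometric
factors times `|n|!/n! * α^n`, where `α` is a multiple of `b` (`prod_radii_le`). As `p < 1` and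
multinomial coefficients are at least one, the `p`-th powers are dominated by a multinomial series
in `α_j^p`, which converges once `J` makes the tail sum of `α_j^p` less than one
(`summable_coeffBound_rpow`). -/

lemma integral_derivative_mul (p q : ℝ[X]) :
    ∫ x in (-1 : ℝ)..1, (derivative p).eval x * q.eval x =
      p.eval 1 * q.eval 1 - p.eval (-1) * q.eval (-1) -
        ∫ x in (-1 : ℝ)..1, p.eval x * (derivative q).eval x := by
  have h := intervalIntegral.integral_mul_deriv_eq_deriv_mul (a := -1) (b := 1)
    (u := fun x => q.eval x) (v := fun x => p.eval x) (u' := fun x => (derivative q).eval x)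
    (v' := fun x => (derivative p).eval x)
    (fun x _ => q.hasDerivAt x) (fun x _ => p.hasDerivAt x)
    ((derivative q).continuous.intervalIntegrable _ _)
    ((derivative p).continuous.intervalIntegrable _ _)
  simp only [mul_comm (eval _ q), mul_comm (eval _ (derivative q))] at h
  exact h

/-- Both `1` and `-1` are zeros of order `n`, and each derivative lowers the order by at most one.
Hence all boundary terms vanish when Rodrigues' formula is integrated by parts. -/
lemma eval_iterate_derivative_sq_sub_one (n k : ℕ) (hk : k < n) (a : ℝ) (ha : a ^ 2 = 1) :
    (derivative^[k] ((X ^ 2 - 1 : ℝ[X]) ^ n)).eval a = 0 := by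
  have h : (X ^ 2 - 1 : ℝ[X]) ^ (n - k) ∣ derivative^[k] ((X ^ 2 - 1 : ℝ[X]) ^ n) :=
    pow_sub_dvd_iterate_derivative_of_pow_dvd k dvd_rfl
  obtain ⟨r, hr⟩ := h
  rw [hr]
  have : n - k ≠ 0 := by omega
  simp [ha, this]

lemma integral_iterate_derivative_mul (n k : ℕ) (hk : k ≤ n) (q : ℝ[X]) :
    ∫ x in (-1 : ℝ)..1, (derivative^[k] ((X ^ 2 - 1 : ℝ[X]) ^ n)).eval x * q.eval x =
      (-1) ^ k * ∫ x in (-1 : ℝ)..1,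
        ((X ^ 2 - 1 : ℝ[X]) ^ n).eval x * (derivative^[k] q).eval x := by
  induction k generalizing q with
  | zero => simp
  | succ k ih =>
    rw [Function.iterate_succ_apply', integral_derivative_mul,
      eval_iterate_derivative_sq_sub_one n k hk 1 (by norm_num),
      eval_iterate_derivative_sq_sub_one n k hk (-1) (by norm_num), ih (by omega),
      Function.iterate_succ_apply]
    ring

lemma integral_legendreP_mul (n : ℕ) (q : ℝ[X]) (hq : q.degree < n) :
    ∫ x in (-1 : ℝ)..1, (legendreP n).eval x * q.eval x = 0 := by
  have h0 : derivative^[n] q = 0 := by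
    by_cases h : q = 0
    · simp [h]
    · exact iterate_derivative_eq_zero ((natDegree_lt_iff_degree_lt h).2 hq)
  simp only [legendreP, eval_mul, eval_C, mul_assoc, intervalIntegral.integral_const_mul]
  rw [integral_iterate_derivative_mul n n le_rfl, h0]
  simp

/-- The Taylor shift of `X ^ 2 - 1` to a root `a` is `X * (X + 2a)`, so its `n`-th power has
`(2a)^n` as coefficient of `X ^ n`. -/
lemma eval_legendreP (n : ℕ) (a : ℝ) (ha : a ^ 2 = 1) : (legendreP n).eval a = a ^ n := by
  have h1 : (derivative^[n] ((X ^ 2 - 1 : ℝ[X]) ^ n)).eval a = n.factorial * (2 * a) ^ n := by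
    rw [← factorial_smul_hasseDeriv, LinearMap.smul_apply, eval_smul, nsmul_eq_mul,
      ← taylor_coeff, taylor_pow]
    congr 1
    have h2 : taylor a (X ^ 2 - 1 : ℝ[X]) = X * (X + C (2 * a)) := by
      simp only [map_sub, taylor_pow, taylor_X, taylor_one, map_mul]
      have : (C a : ℝ[X]) ^ 2 = 1 := by rw [← C_pow, ha, C_1]
      rw [show (C 2 : ℝ[X]) = 2 from rfl]
      rw [C_1]
      linear_combination this
    rw [h2, mul_pow, coeff_X_pow_mul', if_pos le_rfl, Nat.sub_self, coeff_zero_eq_eval_zero]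
    simp
  rw [legendreP, eval_mul, eval_C, h1, mul_pow]
  have := Nat.factorial_ne_zero n
  field_simp

lemma degree_legendreP_le (n : ℕ) : (legendreP n).degree ≤ n := by
  refine degree_le_of_natDegree_le ?_
  refine (natDegree_C_mul_le _ _).trans ((natDegree_iterate_derivative _ _).trans ?_)
  have : ((X ^ 2 - 1 : ℝ[X]) ^ n).natDegree ≤ n * 2 := by
    refine natDegree_pow_le.trans (Nat.mul_le_mul_left _ ?_)
    compute_degree
  omega

/-- With `I` the integral, the leading terms of `X * P'` and `n * P` cancel, so orthogonality gives
`∫ P * (X * P') = n * I`. Integrating `P' * (X * P)` by parts then yields `n * I = 2 - (I + n * I)`.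
-/
lemma integral_legendreP_sq (n : ℕ) :
    (2 * n + 1) * ∫ x in (-1 : ℝ)..1, (legendreP n).eval x * (legendreP n).eval x = 2 := by
  set P := legendreP n with hP
  have hint (p q : ℝ[X]) : IntervalIntegrable (fun x => p.eval x * q.eval x) volume (-1) 1 :=
    (p.continuous.mul q.continuous).intervalIntegrable _ _
  have h1 := integral_derivative_mul P (X * P)
  have h2 : (X * derivative P - C (n : ℝ) * P : ℝ[X]).degree < (n : WithBot ℕ) := by
    have hd : P.degree ≤ n := degree_legendreP_le n
    have hcoeff : ∀ m, n < m → P.coeff m = 0 := fun m hm =>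
      coeff_eq_zero_of_degree_lt (hd.trans_lt (by exact_mod_cast hm))
    rw [degree_lt_iff_coeff_zero]
    intro m hm
    rw [coeff_sub, coeff_C_mul]
    rcases m with _ | m
    · have : n = 0 := by omega
      simp [this]
    · rw [coeff_X_mul, coeff_derivative]
      rcases hm.eq_or_lt with h | h
      · rw [h]; push_cast; ring
      · rw [hcoeff _ h]; ring
  have h3 := integral_legendreP_mul n _ h2
  rw [← hP] at h3
  have h4 : ∫ x in (-1 : ℝ)..1, P.eval x * (X * derivative P).eval x =
      n * ∫ x in (-1 : ℝ)..1, P.eval x * P.eval x := by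
    rw [← intervalIntegral.integral_const_mul, ← sub_eq_zero,
      ← intervalIntegral.integral_sub (hint _ _) ((hint _ _).const_mul _), ← h3]
    congr 1; ext x; simp; ring
  have h5 : ∫ x in (-1 : ℝ)..1, (derivative P).eval x * (X * P).eval x =
      n * ∫ x in (-1 : ℝ)..1, P.eval x * P.eval x := by
    rw [← h4]; congr 1; ext x; simp; ring
  have h6 : ∫ x in (-1 : ℝ)..1, P.eval x * (derivative (X * P)).eval x =
      (∫ x in (-1 : ℝ)..1, P.eval x * P.eval x) +
        n * ∫ x in (-1 : ℝ)..1, P.eval x * P.eval x := by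
    rw [← h4, ← intervalIntegral.integral_add (hint _ _) (hint _ _)]
    congr 1; ext x; simp; ring
  rw [h5, h6] at h1
  have e1 : P.eval 1 = 1 := by rw [hP, eval_legendreP n 1 (by norm_num), one_pow]
  have e2 : P.eval (-1) * P.eval (-1) = 1 := by
    rw [hP, eval_legendreP n (-1) (by norm_num), ← mul_pow]; norm_num
  simp only [eval_mul, eval_X, e1] at h1
  linear_combination h1 + e2

/-- A smaller degree would make the polynomial orthogonal to itself, against the value of its norm.
-/
lemma degree_legendreP (n : ℕ) : (legendreP n).degree = n := by
  refine le_antisymm (degree_legendreP_le n) (not_lt.1 fun h => ?_)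
  have h1 := integral_legendreP_sq n
  rw [integral_legendreP_mul n _ h] at h1
  norm_num at h1

/-- The Legendre polynomials as a sequence of polynomials of increasing degrees. -/
def legendreSeq : Polynomial.Sequence ℝ := ⟨legendreP, degree_legendreP⟩

lemma span_legendreP : Submodule.span ℝ (Set.range legendreP) = ⊤ :=
  legendreSeq.span fun i => (leadingCoeff_ne_zero.2 (legendreSeq.ne_zero i)).isUnit

lemma psi_zero (t : ℝ) : psi 0 t = 1 := by simp [psi, legendreP]

lemma continuous_psi (n : ℕ) : Continuous (psi n) := by
  unfold psi
  exact continuous_const.mul (legendreP n).continuous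

/-- Every polynomial is a linear combination of the functions `psi k`. -/
lemma exists_eval_eq_sum_psi (q : ℝ[X]) :
    ∃ (N : Finset ℕ) (a : ℕ → ℝ), ∀ t : ℝ, q.eval t = ∑ k ∈ N, a k * psi k t := by
  have hq : q ∈ Submodule.span ℝ (Set.range legendreP) := by rw [span_legendreP]; trivial
  obtain ⟨c, hc⟩ := Finsupp.mem_span_range_iff_exists_finsupp.1 hq
  refine ⟨c.support, fun k => c k / Real.sqrt (2 * (k : ℝ) + 1), fun t => ?_⟩
  rw [← hc, Finsupp.sum, eval_finsetSum]
  refine Finset.sum_congr rfl fun k _ => ?_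
  have : Real.sqrt (2 * (k : ℝ) + 1) ≠ 0 := (Real.sqrt_pos.2 (by positivity)).ne'
  rw [eval_smul, smul_eq_mul, psi]
  field_simp

end Legendre

/-! ### Integrals for the uniform measure -/

lemma integral_unif {E : Type*} [NormedAddCommGroup E] [NormedSpace ℝ E] (g : ℝ → E) :
    ∫ y, g y ∂unif = (2 : ℝ)⁻¹ • ∫ x in (-1 : ℝ)..1, g x := by
  rw [unif, integral_smul_measure, integral_subtype_comap measurableSet_Icc g,
    integral_Icc_eq_integral_Ioc, intervalIntegral.integral_of_le (by norm_num)]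
  simp

lemma integral_psi_mul_of_degree_lt (n : ℕ) (q : Polynomial ℝ) (hq : q.degree < n) :
    ∫ y : Set.Icc (-1 : ℝ) 1, psi n y * q.eval (y : ℝ) ∂unif = 0 := by
  rw [integral_unif (fun y => psi n y * q.eval y)]
  simp only [psi, mul_assoc, intervalIntegral.integral_const_mul, integral_legendreP_mul n q hq,
    mul_zero, smul_zero]

lemma integral_psi_mul_psi (n m : ℕ) :
    ∫ y : Set.Icc (-1 : ℝ) 1, psi n y * psi m y ∂unif = if n = m then 1 else 0 := by
  have key (n m : ℕ) (h : m < n) : ∫ y : Set.Icc (-1 : ℝ) 1, psi n y * psi m y ∂unif = 0 := by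
    have := integral_psi_mul_of_degree_lt n
      (Polynomial.C (Real.sqrt (2 * (m : ℝ) + 1)) * legendreP m)
      (by
        rw [Polynomial.degree_C_mul (Real.sqrt_pos.2 (by positivity)).ne', degree_legendreP]
        exact_mod_cast h)
    simpa [psi] using this
  rcases lt_trichotomy n m with h | rfl | h
  · simp only [mul_comm (psi n _), if_neg h.ne]; exact key m n h
  · rw [if_pos rfl, integral_unif (fun y => psi n y * psi n y)]
    have h1 := integral_legendreP_sq n
    have h2 : Real.sqrt (2 * (n : ℝ) + 1) * Real.sqrt (2 * (n : ℝ) + 1) = 2 * n + 1 :=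
      Real.mul_self_sqrt (by positivity)
    have h3 : ∀ x, psi n x * psi n x =
        (2 * n + 1) * ((legendreP n).eval x * (legendreP n).eval x) := by
      intro x; rw [← h2]; simp only [psi]; ring
    simp only [h3, intervalIntegral.integral_const_mul, h1, smul_eq_mul]
    norm_num
  · rw [if_neg h.ne']; exact key n m h

lemma memLp_psi (n : ℕ) (p : ℝ≥0∞) :
    MemLp (fun y : Set.Icc (-1 : ℝ) 1 => psi n y) p unif :=
  ((continuous_psi n).comp continuous_subtype_val).memLp_of_hasCompactSupport
    (HasCompactSupport.of_compactSpace _)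

/-- Since `|x| ≤ (x ^ 2 + 1) / 2`, the `L²` normalization suffices. The bound does not depend on
`n`, so the factor `√(2n+1)` leaves no trace in the coefficient estimates. -/
lemma integral_abs_psi_le (n : ℕ) : ∫ y : Set.Icc (-1 : ℝ) 1, |psi n y| ∂unif ≤ 1 := by
  have hi : Integrable (fun y : Set.Icc (-1 : ℝ) 1 => |psi n y|) unif :=
    ((memLp_psi n 1).integrable le_rfl).abs
  have hi2 : Integrable (fun y : Set.Icc (-1 : ℝ) 1 => psi n y * psi n y) unif := by
    simpa [sq] using (memLp_psi n 2).integrable_sq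
  have h : ∫ y : Set.Icc (-1 : ℝ) 1, |psi n y| ∂unif ≤
      ∫ y : Set.Icc (-1 : ℝ) 1, (psi n y * psi n y + 1) / 2 ∂unif := by
    refine integral_mono hi ((hi2.add (integrable_const _)).div_const _) fun y => ?_
    have := sq_nonneg (|psi n y| - 1)
    have h2 := sq_abs (psi n y)
    dsimp only
    nlinarith
  rw [integral_div, integral_add hi2 (integrable_const _), integral_psi_mul_psi] at h
  simpa using h

/-! ### The Cauchy formula on a Bernstein ellipse -/

/-- The Joukowski map. -/
def joukowski (w : ℂ) : ℂ := (w + w⁻¹) / 2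

/-- The Cauchy kernel of a Bernstein ellipse, pulled back along the Joukowski map. -/
def joukowskiKernel (t w : ℂ) : ℂ := (w ^ 2 - 1) / (w ^ 2 - 2 * t * w + 1)

lemma joukowski_inv (w : ℂ) : joukowski w⁻¹ = joukowski w := by
  simp only [joukowski, inv_inv, add_comm]

lemma joukowski_mem_ellipse {ρ : ℝ} (hρ : 1 ≤ ρ) {w : ℂ} (h1 : ρ⁻¹ ≤ ‖w‖) (h2 : ‖w‖ ≤ ρ) :
    joukowski w ∈ ellipse ρ := by
  by_cases h : 1 ≤ ‖w‖
  · exact ⟨w, h, h2, rfl⟩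
  · have hw : 0 < ‖w‖ := (inv_pos.2 (by linarith)).trans_le h1
    refine ⟨w⁻¹, ?_, ?_, (joukowski_inv w).symm⟩
    · rw [norm_inv]; exact (one_le_inv₀ hw).2 (not_le.1 h).le
    · rw [norm_inv]; exact inv_le_of_inv_le₀ (by linarith) h1

/-- Write `t = cos φ` and take `z = exp (iφ)`; then `T_n(cos φ) = cos (nφ)`. -/
lemma exists_norm_one_joukowski {t : ℝ} (ht : t ∈ Set.Icc (-1 : ℝ) 1) :
    ∃ z : ℂ, ‖z‖ = 1 ∧ (t : ℂ) = joukowski z ∧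
      ∀ n : ℕ, 2 * (((Polynomial.Chebyshev.T ℝ n).eval t : ℝ) : ℂ) = z ^ n + z⁻¹ ^ n := by
  have hc : Real.cos (Real.arccos t) = t := Real.cos_arccos ht.1 ht.2
  set φ := Real.arccos t
  refine ⟨Complex.exp (φ * Complex.I), Complex.norm_exp_ofReal_mul_I φ, ?_, fun n => ?_⟩
  · rw [← hc, joukowski, ← Complex.exp_neg, Complex.ofReal_cos, Complex.cos]
    ring_nf
  · rw [← hc, Polynomial.Chebyshev.T_real_cos, Complex.ofReal_cos, Complex.cos,
      ← Complex.exp_neg, ← Complex.exp_nat_mul, ← Complex.exp_nat_mul]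
    push_cast
    ring_nf

lemma ofReal_mem_ellipse {ρ : ℝ} (hρ : 1 ≤ ρ) {t : ℝ} (ht : t ∈ Set.Icc (-1 : ℝ) 1) :
    (t : ℂ) ∈ ellipse ρ := by
  obtain ⟨z, hz, h, -⟩ := exists_norm_one_joukowski ht
  exact ⟨z, hz.ge, hz.le.trans hρ, h⟩

lemma sq_sub_two_mul_joukowski {z : ℂ} (hz : z ≠ 0) (w : ℂ) :
    w ^ 2 - 2 * joukowski z * w + 1 = (w - z) * (w - z⁻¹) := by
  simp only [joukowski]; field_simp; ring

lemma sq_sub_ne_zero {t : ℝ} (ht : t ∈ Set.Icc (-1 : ℝ) 1) {w : ℂ} (hw : 1 < ‖w‖) :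
    w ^ 2 - 2 * (t : ℂ) * w + 1 ≠ 0 := by
  obtain ⟨z, hz, h, -⟩ := exists_norm_one_joukowski ht
  have hz0 : z ≠ 0 := by rintro rfl; simp at hz
  rw [h, sq_sub_two_mul_joukowski hz0]
  refine mul_ne_zero (fun e => ?_) fun e => ?_
  · rw [sub_eq_zero.1 e] at hw; linarith
  · rw [sub_eq_zero.1 e, norm_inv, hz] at hw; norm_num at hw

section Cauchy

variable {W : Type*} [NormedAddCommGroup W] [NormedSpace ℂ W]

/-- Inversion exchanges the two circles and reverses the angle; periodicity restores the interval.
-/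
lemma intervalIntegral_circleMap_inv_radius (ρ : ℝ) (H : ℂ → W)
    (hH : ∀ w, H w⁻¹ = - H w) :
    ∫ θ in (0 : ℝ)..2 * Real.pi, H (circleMap 0 ρ⁻¹ θ) =
      - ∫ θ in (0 : ℝ)..2 * Real.pi, H (circleMap 0 ρ θ) := by
  have h1 : ∀ θ : ℝ, H (circleMap 0 ρ⁻¹ θ) = - H (circleMap 0 ρ (-θ)) := by
    intro θ
    rw [← hH]
    congr 1
    simp [circleMap, Complex.exp_neg, mul_comm]
  simp only [h1, intervalIntegral.integral_neg]
  congr 1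
  rw [intervalIntegral.integral_comp_neg (fun θ => H (circleMap 0 ρ θ))]
  have hper : Function.Periodic (fun θ => H (circleMap 0 ρ θ)) (2 * Real.pi) := fun θ => by
    simp only [periodic_circleMap 0 ρ θ]
  simpa using hper.intervalIntegral_add_eq (-(2 * Real.pi)) 0

lemma circleIntegral_inv_smul (ρ : ℝ) (hρ : ρ ≠ 0) (H : ℂ → W) :
    ∮ w in C(0, ρ), w⁻¹ • H w =
      Complex.I • ∫ θ in (0 : ℝ)..2 * Real.pi, H (circleMap 0 ρ θ) := by
  rw [circleIntegral, ← intervalIntegral.integral_smul]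
  refine intervalIntegral.integral_congr fun θ _ => ?_
  have : circleMap 0 ρ θ ≠ 0 := circleMap_ne_center hρ
  simp only [deriv_circleMap, smul_smul]
  congr 1
  field_simp

lemma joukowski_sub {w : ℂ} (hw : w ≠ 0) (t : ℂ) :
    joukowski w - t = (w ^ 2 - 2 * t * w + 1) / (2 * w) := by
  simp only [joukowski]; field_simp; ring

/-- Divided by `w`, the kernel is `1/(w-z) + 1/(w-z⁻¹) - 1/w`. All poles lie inside the circle, and
`1 + 1 - 1 = 1`. -/
lemma integral_joukowskiKernel {ρ : ℝ} (hρ : 1 < ρ) {t : ℝ} (ht : t ∈ Set.Icc (-1 : ℝ) 1) :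
    ∫ θ in (0 : ℝ)..2 * Real.pi, joukowskiKernel t (circleMap 0 ρ θ) = 2 * Real.pi := by
  have h0 := circleIntegral_inv_smul ρ (by linarith) (joukowskiKernel t)
  obtain ⟨z, hz, h, -⟩ := exists_norm_one_joukowski ht
  have hz0 : z ≠ 0 := by rintro rfl; simp at hz
  have hzb : z ∈ Metric.ball (0 : ℂ) ρ := by simpa [hz] using hρ
  have hzb' : z⁻¹ ∈ Metric.ball (0 : ℂ) ρ := by simpa [hz] using hρ
  have h0b : (0 : ℂ) ∈ Metric.ball (0 : ℂ) ρ := by simp; linarith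
  have hne : ∀ w ∈ Metric.sphere (0 : ℂ) ρ, ∀ u ∈ Metric.ball (0 : ℂ) ρ, w - u ≠ 0 := by
    intro w hw u hu e
    rw [sub_eq_zero.1 e, mem_sphere_zero_iff_norm] at hw
    rw [mem_ball_zero_iff] at hu
    linarith
  have h1 : ∮ w in C(0, ρ), w⁻¹ • joukowskiKernel t w =
      ∮ w in C(0, ρ), ((w - z)⁻¹ + (w - z⁻¹)⁻¹ - (w - 0)⁻¹) := by
    refine circleIntegral.integral_congr (by linarith) fun w hw => ?_
    have e1 := hne w hw z hzb
    have e2 := hne w hw _ hzb'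
    have e3 := hne w hw 0 h0b
    rw [sub_zero] at e3
    rw [smul_eq_mul, joukowskiKernel, h, sq_sub_two_mul_joukowski hz0, sub_zero]
    have e4 : w * z - 1 ≠ 0 := fun e => e2 (by field_simp; linear_combination e)
    have e5 : w - z⁻¹ = (w * z - 1) / z := by field_simp
    rw [e5]
    field_simp
    ring
  have hci : ∀ u ∈ Metric.ball (0 : ℂ) ρ, CircleIntegrable (fun w : ℂ => (w - u)⁻¹) 0 ρ := by
    intro u hu
    refine ContinuousOn.circleIntegrable (by linarith) ?_
    exact (continuousOn_id.sub continuousOn_const).inv₀ fun w hw => hne w hw u hu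
  have hadd : CircleIntegrable (fun w : ℂ => (w - z)⁻¹ + (w - z⁻¹)⁻¹) 0 ρ :=
    (hci _ hzb).add (hci _ hzb')
  rw [h1, circleIntegral.integral_sub hadd (hci _ h0b),
    circleIntegral.integral_add (hci _ hzb) (hci _ hzb'),
    circleIntegral.integral_sub_inv_of_mem_ball hzb,
    circleIntegral.integral_sub_inv_of_mem_ball hzb',
    circleIntegral.integral_sub_inv_of_mem_ball h0b, smul_eq_mul] at h0
  have := Complex.I_ne_zero
  apply mul_left_cancel₀ this
  rw [← h0]; ring

lemma norm_circleMap_ge {ρ : ℝ} (hρ : 1 < ρ) (θ : ℝ) : 1 < ‖circleMap 0 ρ θ‖ := by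
  rw [norm_circleMap_zero, abs_of_pos (by linarith)]; exact hρ

lemma joukowski_circleMap_mem {ρ : ℝ} (hρ : 1 < ρ) (θ : ℝ) :
    joukowski (circleMap 0 ρ θ) ∈ ellipse ρ := by
  have h : ‖circleMap 0 ρ θ‖ = ρ := by rw [norm_circleMap_zero, abs_of_pos (by linarith)]
  refine joukowski_mem_ellipse hρ.le ?_ h.le
  rw [h]
  exact (inv_le_one_of_one_le₀ hρ.le).trans hρ.le

lemma continuous_joukowski_circleMap {ρ : ℝ} (hρ : 1 < ρ) :
    Continuous fun θ => joukowski (circleMap 0 ρ θ) := by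
  unfold joukowski
  exact ((continuous_circleMap 0 ρ).add ((continuous_circleMap 0 ρ).inv₀
    fun θ => circleMap_ne_center (by linarith))).div_const 2

lemma continuous_comp_joukowski_circleMap {ρ : ℝ} (hρ : 1 < ρ) {F : ℂ → W}
    (hF : ∀ ζ ∈ ellipse ρ, DifferentiableAt ℂ F ζ) :
    Continuous fun θ => F (joukowski (circleMap 0 ρ θ)) :=
  continuous_iff_continuousAt.2 fun θ =>
    (hF _ (joukowski_circleMap_mem hρ θ)).continuousAt.comp
      (f := fun θ => joukowski (circleMap 0 ρ θ)) (continuous_joukowski_circleMap hρ).continuousAt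

lemma continuous_joukowskiKernel {ρ : ℝ} (hρ : 1 < ρ) :
    Continuous fun x : Set.Icc (-1 : ℝ) 1 × ℝ =>
      joukowskiKernel ((x.1 : ℝ) : ℂ) (circleMap 0 ρ x.2) := by
  unfold joukowskiKernel
  refine Continuous.div ?_ ?_ fun x => sq_sub_ne_zero x.1.2 (norm_circleMap_ge hρ x.2) <;>
  · have := (continuous_circleMap 0 ρ).comp (continuous_snd (X := Set.Icc (-1 : ℝ) 1))
    simp only [Function.comp_def] at this
    fun_prop

/-- The Cauchy formula on a Bernstein ellipse. -/
lemma cauchy_ellipse {ρ : ℝ} (hρ : 1 < ρ) {F : ℂ → W}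
    (hF : ∀ ζ ∈ ellipse ρ, DifferentiableAt ℂ F ζ) {t : ℝ} (ht : t ∈ Set.Icc (-1 : ℝ) 1)
    [CompleteSpace W] :
    ∫ θ in (0 : ℝ)..2 * Real.pi,
      joukowskiKernel t (circleMap 0 ρ θ) • F (joukowski (circleMap 0 ρ θ)) =
        (2 * Real.pi : ℂ) • F t := by
  have hρ0 : 0 < ρ := by linarith
  -- The first factor is `w` times the derivative of the Joukowski map, so `H` is the Cauchy
  -- integrand with `F t` subtracted. By `dslope` it stays continuous where the Joukowski map takes
  -- the value `t`.
  set H : ℂ → W := fun w => ((w ^ 2 - 1) / (2 * w)) • dslope F t (joukowski w) with hH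
  have hann : ∀ w ∈ Metric.closedBall (0 : ℂ) ρ \ Metric.ball 0 ρ⁻¹,
      w ≠ 0 ∧ joukowski w ∈ ellipse ρ := by
    rintro w ⟨h1, h2⟩
    rw [mem_closedBall_zero_iff] at h1
    rw [mem_ball_zero_iff, not_lt] at h2
    exact ⟨norm_pos_iff.1 ((inv_pos.2 hρ0).trans_le h2), joukowski_mem_ellipse hρ.le h2 h1⟩
  have hJ : ∀ w : ℂ, w ≠ 0 → DifferentiableAt ℂ joukowski w := fun w hw => by
    unfold joukowski
    exact (differentiableAt_id.add (differentiableAt_inv hw)).div_const 2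
  have hq : ∀ w : ℂ, w ≠ 0 → DifferentiableAt ℂ (fun w : ℂ => (w ^ 2 - 1) / (2 * w)) w :=
    fun w hw => by
      refine DifferentiableAt.div (by fun_prop) (by fun_prop) (by simpa using hw)
  have hFt := hF t (ofReal_mem_ellipse hρ.le ht)
  have hcont : ContinuousOn H (Metric.closedBall (0 : ℂ) ρ \ Metric.ball 0 ρ⁻¹) := by
    intro w hw
    obtain ⟨hw0, hwE⟩ := hann w hw
    refine ContinuousAt.continuousWithinAt ((hq w hw0).continuousAt.smul ?_)
    refine ContinuousAt.comp (g := dslope F t) ?_ (hJ w hw0).continuousAt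
    by_cases h : joukowski w = t
    · rw [h]; exact continuousAt_dslope_same.2 hFt
    · exact (continuousAt_dslope_of_ne h).2 (hF _ hwE).continuousAt
  obtain ⟨z, hz, hzt, -⟩ := exists_norm_one_joukowski ht
  have hz0 : z ≠ 0 := by rintro rfl; simp at hz
  have hdiff : ∀ w ∈ (Metric.ball (0 : ℂ) ρ \ Metric.closedBall 0 ρ⁻¹) \ {z, z⁻¹},
      DifferentiableAt ℂ H w := by
    rintro w ⟨⟨h1, h2⟩, h3⟩
    obtain ⟨hw0, hwE⟩ := hann w ⟨Metric.ball_subset_closedBall h1,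
      fun h => h2 (Metric.ball_subset_closedBall h)⟩
    have hne : joukowski w ≠ t := by
      intro e
      have := joukowski_sub hw0 t
      rw [e, sub_self, eq_comm, div_eq_zero_iff, hzt, sq_sub_two_mul_joukowski hz0] at this
      simp only [mul_eq_zero, sub_eq_zero, hw0, OfNat.ofNat_ne_zero, or_self, or_false] at this
      exact h3 (by simpa using this)
    refine (hq w hw0).smul ?_
    exact DifferentiableAt.comp (g := dslope F t) w
      ((differentiableAt_dslope_of_ne hne).2 (hF _ hwE)) (hJ w hw0)
  -- On the annulus `ρ⁻¹ ≤ |w| ≤ ρ` the Joukowski map stays in the ellipse. Cauchy's theorem allows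
  -- the two exceptional points `z` and `z⁻¹`, and makes the integrals of `H` over both boundary
  -- circles equal. They are also opposite, because `H` is odd under inversion; hence both vanish.
  have hcauchy := Complex.circleIntegral_sub_center_inv_smul_eq_of_differentiable_on_annulus_off_countable
    (c := 0) (inv_pos.2 hρ0) ((inv_le_one_of_one_le₀ hρ.le).trans hρ.le) (s := {z, z⁻¹})
    (Set.toFinite _).countable hcont hdiff
  simp only [sub_zero] at hcauchy
  rw [circleIntegral_inv_smul _ hρ0.ne', circleIntegral_inv_smul _ (inv_pos.2 hρ0).ne',
    intervalIntegral_circleMap_inv_radius] at hcauchy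
  · have hI := smul_right_injective W Complex.I_ne_zero hcauchy
    have hzero : ∫ θ in (0 : ℝ)..2 * Real.pi, H (circleMap 0 ρ θ) = 0 := by
      have h2 : (2 : ℂ) • ∫ θ in (0 : ℝ)..2 * Real.pi, H (circleMap 0 ρ θ) = 0 := by
        rw [two_smul]; nth_rewrite 1 [hI]; exact neg_add_cancel _
      exact (smul_eq_zero.1 h2).resolve_left two_ne_zero
    have hHeq : ∀ θ, H (circleMap 0 ρ θ) =
        joukowskiKernel t (circleMap 0 ρ θ) • F (joukowski (circleMap 0 ρ θ)) -
          joukowskiKernel t (circleMap 0 ρ θ) • F t := by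
      intro θ
      have hw1 := norm_circleMap_ge hρ θ
      set w := circleMap 0 ρ θ
      have hw0 : w ≠ 0 := norm_pos_iff.1 (by linarith)
      have hne := sq_sub_ne_zero ht hw1
      rw [← smul_sub, ← sub_smul_dslope, smul_smul, joukowski_sub hw0, joukowskiKernel]
      simp only [hH]
      congr 1
      rw [div_mul_div_comm, mul_comm (w ^ 2 - 1) (_ + _), mul_div_mul_left _ _ hne]
    have hk : Continuous fun θ => joukowskiKernel t (circleMap 0 ρ θ) :=
      (continuous_joukowskiKernel hρ).comp (f := fun θ : ℝ => ((⟨t, ht⟩ : Set.Icc (-1 : ℝ) 1), θ))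
        (by fun_prop)
    simp only [hHeq] at hzero
    have hc1 : Continuous fun θ =>
        joukowskiKernel t (circleMap 0 ρ θ) • F (joukowski (circleMap 0 ρ θ)) :=
      hk.smul (continuous_comp_joukowski_circleMap hρ hF)
    have hc2 : Continuous fun θ => joukowskiKernel t (circleMap 0 ρ θ) • F t :=
      hk.smul continuous_const
    rw [intervalIntegral.integral_sub (hc1.intervalIntegrable _ _) (hc2.intervalIntegrable _ _),
      intervalIntegral.integral_smul_const,
      integral_joukowskiKernel hρ ht, sub_eq_zero] at hzero
    exact hzero
  · intro w
    simp only [hH, joukowski_inv, ← neg_smul]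
    congr 1
    by_cases hw : w = 0
    · simp [hw]
    · field_simp; ring

end Cauchy

/-! ### Legendre coefficients as integrals over the boundary of an ellipse -/

/-- The uniform probability measure on the interval `(0, 2π]`. -/
def angleMeasure : Measure ℝ :=
  ENNReal.ofReal (2 * Real.pi)⁻¹ • volume.restrict (Set.Ioc 0 (2 * Real.pi))

instance : IsProbabilityMeasure angleMeasure := by
  constructor
  simp only [angleMeasure, Measure.smul_apply, Measure.restrict_apply_univ, Real.volume_Ioc,
    sub_zero, smul_eq_mul]
  rw [← ENNReal.ofReal_mul (by positivity), inv_mul_cancel₀ (by positivity), ENNReal.ofReal_one]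

lemma integral_angleMeasure {E : Type*} [NormedAddCommGroup E] [NormedSpace ℝ E] (g : ℝ → E) :
    ∫ θ, g θ ∂angleMeasure = (2 * Real.pi)⁻¹ • ∫ θ in (0 : ℝ)..2 * Real.pi, g θ := by
  rw [angleMeasure, integral_smul_measure, intervalIntegral.integral_of_le (by positivity),
    ENNReal.toReal_ofReal (by positivity)]

/-- The kernel that represents the `n`-th Legendre coefficient as an integral over the boundary of
the ellipse. -/
def legendreKernel (n : ℕ) (ρ θ : ℝ) : ℂ :=
  ∫ t : Set.Icc (-1 : ℝ) 1, ((psi n t : ℝ) : ℂ) * joukowskiKernel ((t : ℝ) : ℂ) (circleMap 0 ρ θ)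
    ∂unif

lemma continuous_legendreKernel_integrand (n : ℕ) {ρ : ℝ} (hρ : 1 < ρ) :
    Continuous fun x : Set.Icc (-1 : ℝ) 1 × ℝ =>
      ((psi n x.1 : ℝ) : ℂ) * joukowskiKernel ((x.1 : ℝ) : ℂ) (circleMap 0 ρ x.2) := by
  have := (continuous_psi n)
  exact Continuous.mul (by fun_prop) (continuous_joukowskiKernel hρ)

lemma continuous_integrable_unif {E : Type*} [NormedAddCommGroup E]
    {g : Set.Icc (-1 : ℝ) 1 → E} (hg : Continuous g) : Integrable g unif := by
  simpa using hg.continuousOn.integrableOn_compact (μ := unif) isCompact_univ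

lemma norm_pow_div_one_sub_le {u : ℂ} {ρ : ℝ} (hρ : 1 < ρ) (hu : ‖u‖ = ρ⁻¹) (n : ℕ) :
    ‖u ^ n / (1 - u)‖ ≤ ρ / (ρ - 1) * (ρ ^ n)⁻¹ := by
  have h1 : 1 - ρ⁻¹ ≤ ‖1 - u‖ := by
    have := norm_sub_norm_le 1 u
    rwa [norm_one, hu] at this
  have h2 : 0 < 1 - ρ⁻¹ := by linarith [inv_lt_one_of_one_lt₀ hρ]
  rw [norm_div, norm_pow, hu, inv_pow]
  calc (ρ ^ n)⁻¹ / ‖1 - u‖ ≤ (ρ ^ n)⁻¹ / (1 - ρ⁻¹) := by gcongr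
    _ = ρ / (ρ - 1) * (ρ ^ n)⁻¹ := by
      have : ρ - 1 ≠ 0 := by linarith
      have : ρ ≠ 0 := by linarith
      field_simp

/-- With `u = z/w` and `v = 1/(zw)`, both of modulus `ρ⁻¹`, the kernel is `1/(1-u) + 1/(1-v) - 1`.
Since `z^k + z^(-k) = 2 T_k(t)`, the difference is the sum of the two geometric remainders
`u^n/(1-u)` and `v^n/(1-v)`. -/
lemma norm_joukowskiKernel_sub_le (n : ℕ) {ρ : ℝ} (hρ : 1 < ρ) {w : ℂ} (hw : ‖w‖ = ρ)
    {t : ℝ} (ht : t ∈ Set.Icc (-1 : ℝ) 1) :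
    ‖joukowskiKernel t w - (∑ k ∈ Finset.range n,
      2 * (((Polynomial.Chebyshev.T ℝ k).eval t : ℝ) : ℂ) * w⁻¹ ^ k - 1)‖ ≤
        2 * ρ / (ρ - 1) * (ρ ^ n)⁻¹ := by
  obtain ⟨z, hz, hzt, hT⟩ := exists_norm_one_joukowski ht
  have hz0 : z ≠ 0 := by rintro rfl; simp at hz
  have hw0 : w ≠ 0 := norm_pos_iff.1 (by linarith)
  have hu : ‖z * w⁻¹‖ = ρ⁻¹ := by rw [norm_mul, norm_inv, hz, hw, one_mul]
  have hv : ‖z⁻¹ * w⁻¹‖ = ρ⁻¹ := by rw [norm_mul, norm_inv, norm_inv, hz, hw, inv_one, one_mul]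
  have hlt : ρ⁻¹ < 1 := inv_lt_one_of_one_lt₀ hρ
  have hu1 : z * w⁻¹ ≠ 1 := fun e => by rw [e, norm_one] at hu; linarith
  have hv1 : z⁻¹ * w⁻¹ ≠ 1 := fun e => by rw [e, norm_one] at hv; linarith
  have hsum : ∑ k ∈ Finset.range n,
      2 * (((Polynomial.Chebyshev.T ℝ k).eval t : ℝ) : ℂ) * w⁻¹ ^ k =
        ((z * w⁻¹) ^ n - 1) / (z * w⁻¹ - 1) + ((z⁻¹ * w⁻¹) ^ n - 1) / (z⁻¹ * w⁻¹ - 1) := by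
    rw [← geom_sum_eq hu1, ← geom_sum_eq hv1, ← Finset.sum_add_distrib]
    refine Finset.sum_congr rfl fun k _ => ?_
    rw [hT, mul_pow, mul_pow, add_mul]
  have hker : joukowskiKernel t w = 1 / (1 - z * w⁻¹) + 1 / (1 - z⁻¹ * w⁻¹) - 1 := by
    have e1 : w - z ≠ 0 := fun e => hu1 (by rw [sub_eq_zero.1 e]; field_simp)
    have e2 : w * z - 1 ≠ 0 := fun e => hv1 (by rw [← mul_inv, mul_comm z, sub_eq_zero.1 e, inv_one])
    have f1 : 1 - z * w⁻¹ = (w - z) / w := by field_simp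
    have f2 : 1 - z⁻¹ * w⁻¹ = (w * z - 1) / (w * z) := by field_simp
    have f3 : w - z⁻¹ = (w * z - 1) / z := by field_simp
    rw [joukowskiKernel, hzt, sq_sub_two_mul_joukowski hz0, f1, f2, f3]
    field_simp
    ring
  have heq : joukowskiKernel t w - (∑ k ∈ Finset.range n,
      2 * (((Polynomial.Chebyshev.T ℝ k).eval t : ℝ) : ℂ) * w⁻¹ ^ k - 1) =
        (z * w⁻¹) ^ n / (1 - z * w⁻¹) + (z⁻¹ * w⁻¹) ^ n / (1 - z⁻¹ * w⁻¹) := by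
    rw [hsum, hker, ← neg_sub 1 (z * w⁻¹), ← neg_sub 1 (z⁻¹ * w⁻¹)]
    simp only [div_neg, sub_div]
    ring
  rw [heq]
  refine (norm_add_le _ _).trans ((add_le_add (norm_pow_div_one_sub_le hρ hu n)
    (norm_pow_div_one_sub_le hρ hv n)).trans (le_of_eq ?_))
  ring

/-- The Chebyshev partial sum has degree below `n` in `t`, so subtracting it does not change the
integral against `psi n`. The condition `n ≠ 0` is needed for the constant term `-1`. -/
lemma norm_legendreKernel_le {n : ℕ} (hn : n ≠ 0) {ρ : ℝ} (hρ : 1 < ρ) (θ : ℝ) :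
    ‖legendreKernel n ρ θ‖ ≤ 2 * ρ / (ρ - 1) * (ρ ^ n)⁻¹ := by
  have hw : ‖circleMap 0 ρ θ‖ = ρ := by rw [norm_circleMap_zero, abs_of_pos (by linarith)]
  set w := circleMap 0 ρ θ with hwdef
  set q : ℝ → ℂ := fun t => ∑ k ∈ Finset.range n,
      2 * (((Polynomial.Chebyshev.T ℝ k).eval t : ℝ) : ℂ) * w⁻¹ ^ k - 1 with hq
  have hpsi := continuous_psi n
  have horth (p : Polynomial ℝ) (hp : p.degree < n) :
      ∫ t : Set.Icc (-1 : ℝ) 1, ((psi n t : ℝ) : ℂ) * ((p.eval (t : ℝ) : ℝ) : ℂ) ∂unif = 0 := by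
    have := integral_psi_mul_of_degree_lt n p hp
    rw [← Complex.ofReal_zero, ← this, ← integral_complex_ofReal]
    push_cast; rfl
  have hcontp (p : Polynomial ℝ) : Continuous fun t : Set.Icc (-1 : ℝ) 1 =>
      ((psi n t : ℝ) : ℂ) * ((p.eval (t : ℝ) : ℝ) : ℂ) := by
    have := p.continuous
    fun_prop
  have hq0 : ∫ t : Set.Icc (-1 : ℝ) 1, ((psi n t : ℝ) : ℂ) * q t ∂unif = 0 := by
    have e : ∀ t : Set.Icc (-1 : ℝ) 1, ((psi n t : ℝ) : ℂ) * q t =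
        ∑ k ∈ Finset.range n, (2 * w⁻¹ ^ k) *
          (((psi n t : ℝ) : ℂ) * (((Polynomial.Chebyshev.T ℝ k).eval (t : ℝ) : ℝ) : ℂ)) -
        ((psi n t : ℝ) : ℂ) * (((1 : Polynomial ℝ).eval (t : ℝ) : ℝ) : ℂ) := by
      intro t
      simp only [hq, mul_sub, Finset.mul_sum, Polynomial.eval_one, Complex.ofReal_one, mul_one]
      congr 1
      exact Finset.sum_congr rfl fun k _ => by ring
    simp only [e]
    rw [integral_sub, integral_finsetSum]
    · rw [horth 1 (by rw [Polynomial.degree_one]; exact_mod_cast Nat.pos_of_ne_zero hn), sub_zero]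
      refine Finset.sum_eq_zero fun k hk => ?_
      rw [integral_const_mul, horth, mul_zero]
      rw [Polynomial.Chebyshev.degree_T]
      exact_mod_cast Finset.mem_range.1 hk
    · exact fun k _ => (continuous_integrable_unif (hcontp _)).const_mul _
    · exact integrable_finsetSum _ fun k _ => (continuous_integrable_unif (hcontp _)).const_mul _
    · exact continuous_integrable_unif (hcontp _)
  have hcq : Continuous fun t : Set.Icc (-1 : ℝ) 1 => ((psi n t : ℝ) : ℂ) * q t := by
    have := fun k : ℕ => (Polynomial.Chebyshev.T ℝ k).continuous
    simp only [hq]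
    fun_prop
  have hck : Continuous fun t : Set.Icc (-1 : ℝ) 1 =>
      ((psi n t : ℝ) : ℂ) * joukowskiKernel ((t : ℝ) : ℂ) w :=
    (continuous_legendreKernel_integrand n hρ).comp
      (f := fun t : Set.Icc (-1 : ℝ) 1 => (t, θ)) (by fun_prop)
  have heq : legendreKernel n ρ θ =
      ∫ t : Set.Icc (-1 : ℝ) 1, (((psi n t : ℝ) : ℂ) * joukowskiKernel ((t : ℝ) : ℂ) w -
        ((psi n t : ℝ) : ℂ) * q t) ∂unif := by
    rw [integral_sub (continuous_integrable_unif hck) (continuous_integrable_unif hcq), hq0,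
      sub_zero, legendreKernel]
  have hC : 0 ≤ 2 * ρ / (ρ - 1) * (ρ ^ n)⁻¹ := by
    have : 0 < ρ - 1 := by linarith
    positivity
  rw [heq]
  calc _ ≤ ∫ t : Set.Icc (-1 : ℝ) 1, |psi n t| * (2 * ρ / (ρ - 1) * (ρ ^ n)⁻¹) ∂unif := by
        refine norm_integral_le_of_norm_le (continuous_integrable_unif (by fun_prop))
          (ae_of_all _ fun t => ?_)
        rw [← mul_sub, norm_mul, Complex.norm_real, Real.norm_eq_abs]
        exact mul_le_mul_of_nonneg_left (norm_joukowskiKernel_sub_le n hρ hw t.2) (abs_nonneg _)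
    _ ≤ 2 * ρ / (ρ - 1) * (ρ ^ n)⁻¹ := by
        rw [integral_mul_const]
        exact mul_le_of_le_one_left hC (integral_abs_psi_le n)

/-- The Legendre coefficients of a function that is holomorphic on a Bernstein ellipse. -/
lemma integral_psi_smul_eq {W : Type*} [NormedAddCommGroup W] [NormedSpace ℂ W] [CompleteSpace W]
    (n : ℕ) {ρ : ℝ} (hρ : 1 < ρ) {F : ℂ → W} (hF : ∀ ζ ∈ ellipse ρ, DifferentiableAt ℂ F ζ) :
    ∫ t : Set.Icc (-1 : ℝ) 1, ((psi n t : ℝ) : ℂ) • F ((t : ℝ) : ℂ) ∂unif =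
      ∫ θ, legendreKernel n ρ θ • F (joukowski (circleMap 0 ρ θ)) ∂angleMeasure := by
  have h1 : ∀ t : Set.Icc (-1 : ℝ) 1, ((psi n t : ℝ) : ℂ) • F ((t : ℝ) : ℂ) =
      ∫ θ, (((psi n t : ℝ) : ℂ) * joukowskiKernel ((t : ℝ) : ℂ) (circleMap 0 ρ θ)) •
        F (joukowski (circleMap 0 ρ θ)) ∂angleMeasure := by
    intro t
    simp only [mul_smul]
    rw [integral_smul, integral_angleMeasure, cauchy_ellipse hρ hF t.2,
      ← Complex.coe_smul, smul_smul (_ : ℂ) (_ : ℂ) (F _)]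
    congr 1
    push_cast
    rw [inv_mul_cancel₀ (by simp), one_smul]
  simp only [h1]
  -- Fubini applies because the integrand is jointly continuous on the compact set `[-1,1] ×
  -- [0,2π]`.
  rw [integral_integral_swap]
  · refine integral_congr_ae (ae_of_all _ fun θ => ?_)
    simp only [legendreKernel]
    rw [integral_smul_const]
  · have hc : Continuous (Function.uncurry fun (t : Set.Icc (-1 : ℝ) 1) (θ : ℝ) =>
        (((psi n t : ℝ) : ℂ) * joukowskiKernel ((t : ℝ) : ℂ) (circleMap 0 ρ θ)) •
          F (joukowski (circleMap 0 ρ θ))) :=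
      (continuous_legendreKernel_integrand n hρ).smul
        ((continuous_comp_joukowski_circleMap hρ hF).comp continuous_snd)
    have hI : IntegrableOn (Function.uncurry fun (t : Set.Icc (-1 : ℝ) 1) (θ : ℝ) =>
        (((psi n t : ℝ) : ℂ) * joukowskiKernel ((t : ℝ) : ℂ) (circleMap 0 ρ θ)) •
          F (joukowski (circleMap 0 ρ θ))) (Set.univ ×ˢ Set.Icc 0 (2 * Real.pi))
          (unif.prod volume) :=
      hc.continuousOn.integrableOn_compact (isCompact_univ.prod isCompact_Icc)
    rw [angleMeasure, Measure.prod_smul_right]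
    refine Integrable.smul_measure ?_ ENNReal.ofReal_ne_top
    have := hI.mono_set (Set.prod_mono_right (s := Set.univ)
      (Set.Ioc_subset_Icc_self (a := 0) (b := 2 * Real.pi)))
    rwa [IntegrableOn, ← Measure.prod_restrict, Measure.restrict_univ] at this

/-! ### Tensor products of one-dimensional integration rules -/

lemma measurePreserving_cons {m : ℕ} (μ : Fin (m + 1) → Measure ℝ) [∀ i, SigmaFinite (μ i)] :
    MeasurePreserving (fun x : ℝ × (Fin m → ℝ) => (Fin.cons x.1 x.2 : Fin (m + 1) → ℝ))
      ((μ 0).prod (Measure.pi fun i => μ i.succ)) (Measure.pi μ) := by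
  have h := (measurePreserving_piFinSuccAbove μ 0).symm
  have e : (fun x : ℝ × (Fin m → ℝ) => (Fin.cons x.1 x.2 : Fin (m + 1) → ℝ)) =
      (MeasurableEquiv.piFinSuccAbove (fun _ : Fin (m + 1) => ℝ) 0).symm := by
    ext x : 1
    exact (Fin.insertNth_zero' x.1 x.2).symm
  rw [e]
  exact h

/-- A separately continuous function is strongly measurable. -/
lemma stronglyMeasurable_of_separately_continuous {E : Type*} [TopologicalSpace E]
    [TopologicalSpace.PseudoMetrizableSpace E] {m : ℕ} {φ : (Fin m → ℝ) → E}
    (h : ∀ x j, Continuous fun s => φ (Function.update x j s)) : StronglyMeasurable φ := by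
  induction m with
  | zero => exact stronglyMeasurable_const' fun x y => by rw [Subsingleton.elim x y]
  | succ m ih =>
    -- A Carathéodory function: continuous in the first variable and, by induction, measurable in
    -- the others.
    have h1 : StronglyMeasurable
        (Function.uncurry fun (s : ℝ) (x : Fin m → ℝ) => φ (Fin.cons s x)) := by
      refine stronglyMeasurable_uncurry_of_continuous_of_stronglyMeasurable (fun x => ?_)
        fun s => ih fun x j => ?_
      · simpa only [Fin.update_cons_zero] using h (Fin.cons 0 x) 0
      · simpa only [Fin.cons_update] using h (Fin.cons s x) j.succ
    have h2 : Measurable fun x : Fin (m + 1) → ℝ => (x 0, Fin.tail x) := by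
      refine (measurable_pi_apply 0).prodMk (measurable_pi_iff.2 fun j => measurable_pi_apply _)
    have h3 := h1.comp_measurable h2
    simpa only [Function.comp_def, Function.uncurry, Fin.cons_self_tail] using h3

/-- A weighted integral over a curve in a set `E` of complex numbers. -/
structure CurveRule (E : Set ℂ) where
  /-- The measure on the parameter space. -/
  measure : Measure ℝ
  isProb : IsProbabilityMeasure measure
  /-- The curve. -/
  node : ℝ → ℂ
  continuous_node : Continuous node
  node_mem : ∀ s, node s ∈ E
  /-- The weight. -/
  weight : ℝ → ℂ
  measurable_weight : Measurable weight
  /-- A bound for the weight. -/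
  bound : ℝ
  norm_weight_le : ∀ s, ‖weight s‖ ≤ bound

namespace CurveRule

instance {E : Set ℂ} (R : CurveRule E) : IsProbabilityMeasure R.measure := R.isProb

variable {W : Type*} [NormedAddCommGroup W] [NormedSpace ℂ W]

/-- The integral of a function for the rule. -/
def integral {E : Set ℂ} (R : CurveRule E) (F : ℂ → W) : W :=
  ∫ s, R.weight s • F (R.node s) ∂(R.measure)

lemma bound_nonneg {E : Set ℂ} (R : CurveRule E) : 0 ≤ R.bound :=
  (norm_nonneg _).trans (R.norm_weight_le 0)

/-- The integrand of a tensor product of rules. -/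
def integrand {m : ℕ} {E : Fin m → Set ℂ} (R : ∀ i, CurveRule (E i)) (h : (Fin m → ℂ) → W)
    (x : Fin m → ℝ) : W :=
  (∏ i, (R i).weight (x i)) • h fun i => (R i).node (x i)

/-- The integral of a function for a tensor product of rules. -/
def multi {m : ℕ} {E : Fin m → Set ℂ} (R : ∀ i, CurveRule (E i)) (h : (Fin m → ℂ) → W) : W :=
  ∫ x, integrand R h x ∂Measure.pi fun i => (R i).measure

end CurveRule

/-- Functions on a product of sets that are separately holomorphic and bounded by one. -/
structure SepHolo {W : Type*} [NormedAddCommGroup W] [NormedSpace ℂ W] {m : ℕ}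
    (E : Fin m → Set ℂ) (h : (Fin m → ℂ) → W) : Prop where
  diff : ∀ z, (∀ i, z i ∈ E i) → ∀ j,
    DifferentiableAt ℂ (fun ζ => h (Function.update z j ζ)) (z j)
  norm_le : ∀ z, (∀ i, z i ∈ E i) → ‖h z‖ ≤ 1

namespace SepHolo

variable {W : Type*} [NormedAddCommGroup W] [NormedSpace ℂ W] {m : ℕ}

lemma slice {E : Fin (m + 1) → Set ℂ} {h : (Fin (m + 1) → ℂ) → W} (hh : SepHolo E h) {ζ : ℂ}
    (hζ : ζ ∈ E 0) : SepHolo (fun i => E i.succ) fun z => h (Fin.cons ζ z) where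
  diff z hz j := by
    simpa only [Fin.cons_update, Fin.cons_succ] using
      hh.diff (Fin.cons ζ z) (Fin.cases hζ hz) j.succ
  norm_le z hz := hh.norm_le _ (Fin.cases hζ hz)

lemma diff_zero {E : Fin (m + 1) → Set ℂ} {h : (Fin (m + 1) → ℂ) → W} (hh : SepHolo E h)
    {z : Fin m → ℂ} (hz : ∀ i, z i ∈ E i.succ) :
    ∀ ζ ∈ E 0, DifferentiableAt ℂ (fun ζ => h (Fin.cons ζ z)) ζ := by
  intro ζ hζ
  simpa only [Fin.update_cons_zero, Fin.cons_zero] using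
    hh.diff (Fin.cons ζ z) (Fin.cases hζ hz) 0

/-- Separate holomorphy gives separate continuity along the curves, which suffices for
measurability; no Hartogs-type theorem enters. -/
lemma stronglyMeasurable_comp {E : Fin m → Set ℂ} {h : (Fin m → ℂ) → W} (hh : SepHolo E h)
    (R : ∀ i, CurveRule (E i)) :
    StronglyMeasurable fun x : Fin m → ℝ => h fun i => (R i).node (x i) := by
  refine stronglyMeasurable_of_separately_continuous fun x j => ?_
  have e : ∀ s, (fun i => (R i).node (Function.update x j s i)) =
      Function.update (fun i => (R i).node (x i)) j ((R j).node s) := by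
    intro s
    ext i
    by_cases hij : i = j
    · subst hij; simp
    · simp [hij]
  simp only [e]
  refine continuous_iff_continuousAt.2 fun s => ?_
  refine ContinuousAt.comp (g := fun ζ => h (Function.update (fun i => (R i).node (x i)) j ζ)) ?_
    (R j).continuous_node.continuousAt
  have := hh.diff (Function.update (fun i => (R i).node (x i)) j ((R j).node s)) (fun i => ?_) j
  · simpa using this.continuousAt
  · by_cases hij : i = j
    · subst hij; simpa using (R i).node_mem s
    · simpa [hij] using (R i).node_mem _

lemma norm_integrand_le {E : Fin m → Set ℂ} {h : (Fin m → ℂ) → W} (hh : SepHolo E h)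
    (R : ∀ i, CurveRule (E i)) (x : Fin m → ℝ) :
    ‖CurveRule.integrand R h x‖ ≤ ∏ i, (R i).bound := by
  rw [CurveRule.integrand, norm_smul, norm_prod]
  calc _ ≤ (∏ i, (R i).bound) * 1 := by
        refine mul_le_mul (Finset.prod_le_prod (fun _ _ => norm_nonneg _)
          fun i _ => (R i).norm_weight_le _) (hh.norm_le _ fun i => (R i).node_mem _)
          (norm_nonneg _) (Finset.prod_nonneg fun i _ => (R i).bound_nonneg)
    _ = _ := mul_one _

lemma stronglyMeasurable_integrand {E : Fin m → Set ℂ} {h : (Fin m → ℂ) → W} (hh : SepHolo E h)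
    (R : ∀ i, CurveRule (E i)) : StronglyMeasurable (CurveRule.integrand R h) := by
  refine StronglyMeasurable.smul ?_ (hh.stronglyMeasurable_comp R)
  refine Measurable.stronglyMeasurable ?_
  exact Finset.measurable_prod _ fun i _ => (R i).measurable_weight.comp (measurable_pi_apply i)

lemma integrable_integrand {E : Fin m → Set ℂ} {h : (Fin m → ℂ) → W} (hh : SepHolo E h)
    (R : ∀ i, CurveRule (E i)) :
    Integrable (CurveRule.integrand R h) (Measure.pi fun i => (R i).measure) :=
  Integrable.of_bound (hh.stronglyMeasurable_integrand R).aestronglyMeasurable _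
    (ae_of_all _ (hh.norm_integrand_le R))

lemma norm_multi_le {E : Fin m → Set ℂ} {h : (Fin m → ℂ) → W} (hh : SepHolo E h)
    (R : ∀ i, CurveRule (E i)) : ‖CurveRule.multi R h‖ ≤ ∏ i, (R i).bound := by
  have := norm_integral_le_of_norm_le_const (μ := Measure.pi fun i => (R i).measure)
    (ae_of_all _ (hh.norm_integrand_le R))
  simpa [CurveRule.multi] using this

lemma integrand_cons {E : Fin (m + 1) → Set ℂ} (R : ∀ i, CurveRule (E i))
    (h : (Fin (m + 1) → ℂ) → W) (s : ℝ) (x : Fin m → ℝ) :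
    CurveRule.integrand R h (Fin.cons s x) = (R 0).weight s •
      CurveRule.integrand (fun i => R i.succ) (fun z => h (Fin.cons ((R 0).node s) z)) x := by
  have e : (fun i => (R i).node ((Fin.cons s x : Fin (m + 1) → ℝ) i)) =
      Fin.cons ((R 0).node s) fun i : Fin m => (R i.succ).node (x i) := by
    ext i
    refine Fin.cases ?_ (fun i => ?_) i <;> simp
  simp only [CurveRule.integrand, e, Fin.prod_univ_succ, Fin.cons_zero, Fin.cons_succ, mul_smul]

lemma multi_succ [CompleteSpace W] {E : Fin (m + 1) → Set ℂ} {h : (Fin (m + 1) → ℂ) → W} (hh : SepHolo E h)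
    (R : ∀ i, CurveRule (E i)) :
    CurveRule.multi R h =
      (R 0).integral fun ζ => CurveRule.multi (fun i => R i.succ) fun z => h (Fin.cons ζ z) := by
  have hmp := measurePreserving_cons fun i => (R i).measure
  have hint : Integrable (fun x : ℝ × (Fin m → ℝ) => CurveRule.integrand R h (Fin.cons x.1 x.2))
      ((R 0).measure.prod (Measure.pi fun i => (R i.succ).measure)) :=
    (hmp.integrable_comp (hh.integrable_integrand R).aestronglyMeasurable).2
      (hh.integrable_integrand R)
  rw [CurveRule.multi, ← hmp.map_eq, integral_map hmp.measurable.aemeasurable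
    (hh.stronglyMeasurable_integrand R).aestronglyMeasurable, integral_prod _ hint]
  simp only [CurveRule.integral, CurveRule.multi, integrand_cons, integral_smul]

/-- In this order of integration the rule of coordinate `0` acts innermost, on a slice of `h` that
is holomorphic by assumption. In the order of `multi_succ` it would act on a partial integral, whose
holomorphy would have to be proved. -/
lemma multi_succ_symm [CompleteSpace W] {E : Fin (m + 1) → Set ℂ} {h : (Fin (m + 1) → ℂ) → W} (hh : SepHolo E h)
    (R : ∀ i, CurveRule (E i)) :
    CurveRule.multi R h =
      ∫ x, (∏ i, (R i.succ).weight (x i)) •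
        ((R 0).integral fun ζ => h (Fin.cons ζ fun i => (R i.succ).node (x i)))
        ∂Measure.pi fun i => (R i.succ).measure := by
  have hmp := measurePreserving_cons fun i => (R i).measure
  have hint : Integrable (fun x : ℝ × (Fin m → ℝ) => CurveRule.integrand R h (Fin.cons x.1 x.2))
      ((R 0).measure.prod (Measure.pi fun i => (R i.succ).measure)) :=
    (hmp.integrable_comp (hh.integrable_integrand R).aestronglyMeasurable).2
      (hh.integrable_integrand R)
  rw [CurveRule.multi, ← hmp.map_eq, integral_map hmp.measurable.aemeasurable
    (hh.stronglyMeasurable_integrand R).aestronglyMeasurable, integral_prod_symm _ hint]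
  refine integral_congr_ae (ae_of_all _ fun x => ?_)
  simp only [integrand_cons, CurveRule.integral]
  rw [← integral_smul]
  refine integral_congr_ae (ae_of_all _ fun s => ?_)
  exact smul_comm _ _ _

/-- Rules that agree on holomorphic functions have tensor products that agree on separately
holomorphic functions. -/
lemma multi_eq [CompleteSpace W] {E : Fin m → Set ℂ} {h : (Fin m → ℂ) → W} (hh : SepHolo E h)
    (R R' : ∀ i, CurveRule (E i))
    (hR : ∀ i (F : ℂ → W), (∀ ζ ∈ E i, DifferentiableAt ℂ F ζ) →
      (R i).integral F = (R' i).integral F) :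
    CurveRule.multi R h = CurveRule.multi R' h := by
  induction m with
  | zero =>
    have e : R = R' := funext fun i => i.elim0
    rw [e]
  | succ m ih =>
    -- The hybrid family differs from `R` only in the later coordinates, where induction applies to
    -- slices, and from `R'` only in coordinate `0`.
    let Q : ∀ i, CurveRule (E i) := Fin.cons (R 0) fun i => R' i.succ
    have h1 : CurveRule.multi R h = CurveRule.multi Q h := by
      rw [hh.multi_succ R, hh.multi_succ Q]
      refine integral_congr_ae (ae_of_all _ fun s => ?_)
      change (R 0).weight s • _ = (R 0).weight s • _
      congr 1
      exact ih (hh.slice ((R 0).node_mem s)) _ _ fun i => hR i.succ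
    have h2 : CurveRule.multi Q h = CurveRule.multi R' h := by
      rw [hh.multi_succ_symm Q, hh.multi_succ_symm R']
      refine integral_congr_ae (ae_of_all _ fun x => ?_)
      change (∏ i, (R' (Fin.succ i)).weight (x i)) • (R 0).integral _ =
        (∏ i, (R' (Fin.succ i)).weight (x i)) • (R' 0).integral _
      congr 1
      exact hR 0 _ (hh.diff_zero fun i => (R' i.succ).node_mem _)
    rw [h1, h2]

end SepHolo

/-! ### The rules of a Legendre coefficient -/

/-- The retraction of the real line onto `[-1,1]`. -/
def clamp (s : ℝ) : Set.Icc (-1 : ℝ) 1 := Set.projIcc (-1) 1 (by norm_num) s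

lemma continuous_clamp : Continuous clamp := continuous_projIcc (h := by norm_num)

lemma clamp_coe (t : Set.Icc (-1 : ℝ) 1) : clamp t = t := Set.projIcc_val _ t

lemma exists_psi_bound (n : ℕ) : ∃ C, ∀ t : Set.Icc (-1 : ℝ) 1, ‖((psi n t : ℝ) : ℂ)‖ ≤ C := by
  have hc : Continuous fun t : Set.Icc (-1 : ℝ) 1 => ((psi n t : ℝ) : ℂ) := by
    have := continuous_psi n
    fun_prop
  obtain ⟨C, hC⟩ := isCompact_univ.exists_bound_of_continuousOn hc.continuousOn
  exact ⟨C, fun t => hC t trivial⟩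

/-- Integration against `psi n` for the uniform measure on `[-1,1]`. -/
def unifRule (n : ℕ) (ρ : ℝ) (hρ : 1 ≤ ρ) : CurveRule (ellipse ρ) where
  measure := unif.map Subtype.val
  isProb := Measure.isProbabilityMeasure_map measurable_subtype_coe.aemeasurable
  node s := ((clamp s : ℝ) : ℂ)
  continuous_node := by have := continuous_clamp; fun_prop
  node_mem s := ofReal_mem_ellipse hρ (clamp s).2
  weight s := ((psi n (clamp s) : ℝ) : ℂ)
  measurable_weight := by
    have h1 := continuous_clamp
    have h2 := continuous_psi n
    exact Continuous.measurable (by fun_prop)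
  -- For `n = 0` the rule is kept, and the exact value `1` makes coordinates outside the support
  -- contribute nothing. For `n ≠ 0` any finite bound will do, as the boundary rule takes over.
  bound := if n = 0 then 1 else (exists_psi_bound n).choose
  norm_weight_le s := by
    split_ifs with h
    · subst h; simp [psi_zero]
    · exact (exists_psi_bound n).choose_spec _

lemma measurable_legendreKernel (n : ℕ) {ρ : ℝ} (hρ : 1 < ρ) : Measurable (legendreKernel n ρ) :=
  ((continuous_legendreKernel_integrand n hρ).stronglyMeasurable.integral_prod_left').measurable

/-- Integration against the Legendre kernel over the boundary of an ellipse. -/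
def boundaryRule (n : ℕ) (hn : n ≠ 0) (ρ : ℝ) (hρ : 1 < ρ) : CurveRule (ellipse ρ) where
  measure := angleMeasure
  isProb := inferInstance
  node θ := joukowski (circleMap 0 ρ θ)
  continuous_node := continuous_joukowski_circleMap hρ
  node_mem := joukowski_circleMap_mem hρ
  weight := legendreKernel n ρ
  measurable_weight := measurable_legendreKernel n hρ
  bound := 2 * ρ / (ρ - 1) * (ρ ^ n)⁻¹
  norm_weight_le := norm_legendreKernel_le hn hρ

lemma integral_unifRule {W : Type*} [NormedAddCommGroup W] [NormedSpace ℂ W] {n : ℕ} {ρ : ℝ}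
    (hρ : 1 ≤ ρ) {F : ℂ → W} :
    (unifRule n ρ hρ).integral F =
      ∫ t : Set.Icc (-1 : ℝ) 1, ((psi n t : ℝ) : ℂ) • F ((t : ℝ) : ℂ) ∂unif := by
  have hemb : MeasurableEmbedding (Subtype.val : Set.Icc (-1 : ℝ) 1 → ℝ) :=
    MeasurableEmbedding.subtype_coe measurableSet_Icc
  simp only [CurveRule.integral, unifRule]
  rw [hemb.integral_map]
  simp only [clamp_coe]

/-- A rule that computes the same integrals as `unifRule` with a small weight. -/
lemma exists_rule_bound {n : ℕ} {ρ : ℝ} (hρ : 1 ≤ ρ) (hn : n ≠ 0 → 1 < ρ) :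
    ∃ R : CurveRule (ellipse ρ),
      R.bound = (if n = 0 then 1 else 2 * ρ / (ρ - 1) * (ρ ^ n)⁻¹) ∧
      ∀ {W : Type*} [NormedAddCommGroup W] [NormedSpace ℂ W] [CompleteSpace W] (F : ℂ → W),
        (∀ ζ ∈ ellipse ρ, DifferentiableAt ℂ F ζ) →
          (unifRule n ρ hρ).integral F = R.integral F := by
  by_cases h : n = 0
  · exact ⟨unifRule n ρ hρ, by simp [unifRule, h], fun F _ => rfl⟩
  · refine ⟨boundaryRule n h ρ (hn h), by simp [boundaryRule, h], fun F hF => ?_⟩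
    rw [integral_unifRule, integral_psi_smul_eq n (hn h) hF]
    rfl

/-! ### Splitting off finitely many coordinates -/

instance : IsProbabilityMeasure unifDom := by unfold unifDom; infer_instance

/-- The point with the first `m` coordinates of `x` and the other coordinates of `y`. -/
def mix (m : ℕ) (x y : Dom) : Dom := fun j => if j < m then x j else y j

/-- Two independent copies of the whole space make it possible to integrate over the first `m`
coordinates and then the others without splitting the index set. It is enough to compare boxes with
finitely many constrained coordinates. -/
lemma measurePreserving_mix (m : ℕ) :
    MeasurePreserving (fun q : Dom × Dom => mix m q.1 q.2) (unifDom.prod unifDom) unifDom := by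
  have hmeas : Measurable fun q : Dom × Dom => mix m q.1 q.2 := by
    refine measurable_pi_iff.2 fun j => ?_
    unfold mix
    split_ifs
    · exact (measurable_pi_apply j).comp measurable_fst
    · exact (measurable_pi_apply j).comp measurable_snd
  refine ⟨hmeas, ?_⟩
  refine Measure.eq_infinitePi _ fun s t ht => ?_
  rw [Measure.map_apply hmeas (MeasurableSet.pi s.countable_toSet fun i _ => ht i)]
  have e : (fun q : Dom × Dom => mix m q.1 q.2) ⁻¹' (Set.pi s t) =
      (Set.pi (s.filter (· < m) : Finset ℕ) t) ×ˢ (Set.pi (s.filter (¬ · < m) : Finset ℕ) t) := by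
    ext q
    simp only [Set.mem_preimage, Set.mem_pi, Set.mem_prod, Finset.coe_filter, Set.mem_ofPred_eq,
      Finset.mem_coe, mix]
    constructor
    · refine fun h => ⟨fun i hi => ?_, fun i hi => ?_⟩
      · simpa [hi.2] using h i hi.1
      · simpa [hi.2] using h i hi.1
    · intro h i hi
      by_cases him : i < m
      · simpa [him] using h.1 i ⟨hi, him⟩
      · simpa [him] using h.2 i ⟨hi, him⟩
  rw [e, Measure.prod_prod, unifDom, Measure.infinitePi_pi _ fun i _ => ht i,
    Measure.infinitePi_pi _ fun i _ => ht i]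
  exact Finset.prod_filter_mul_prod_filter_not s (· < m) fun i => unif (t i)

/-- The first `m` coordinates. -/
def initial (m : ℕ) (x : Dom) : Fin m → ℝ := fun i => x i

lemma measurable_initial (m : ℕ) : Measurable (initial m) :=
  measurable_pi_iff.2 fun _ => measurable_subtype_coe.comp (measurable_pi_apply _)

lemma map_initial (m : ℕ) :
    unifDom.map (initial m) = Measure.pi fun _ : Fin m => unif.map Subtype.val := by
  have : ∀ _ : Fin m, IsProbabilityMeasure (unif.map (Subtype.val : Set.Icc (-1 : ℝ) 1 → ℝ)) :=
    fun _ => Measure.isProbabilityMeasure_map measurable_subtype_coe.aemeasurable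
  symm
  refine Measure.pi_eq fun t ht => ?_
  rw [Measure.map_apply (measurable_initial m) (MeasurableSet.univ_pi ht)]
  let t' : ℕ → Set (Set.Icc (-1 : ℝ) 1) := fun j =>
    if h : j < m then Subtype.val ⁻¹' t ⟨j, h⟩ else Set.univ
  have e : initial m ⁻¹' Set.univ.pi t = Set.pi (Finset.range m : Finset ℕ) t' := by
    ext x
    simp only [Set.mem_preimage, Set.mem_pi, Set.mem_univ, true_imp_iff, Finset.coe_range,
      Set.mem_Iio, initial, t']
    constructor
    · intro h j hj
      simpa [hj] using h ⟨j, hj⟩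
    · intro h i
      simpa using h i i.2
  have ht' : ∀ j, MeasurableSet (t' j) := by
    intro j
    simp only [t']
    split_ifs with h
    · exact measurable_subtype_coe (ht _)
    · exact MeasurableSet.univ
  rw [e, unifDom, Measure.infinitePi_pi _ fun i _ => ht' i, Finset.prod_range]
  refine Finset.prod_congr rfl fun i _ => ?_
  rw [Measure.map_apply measurable_subtype_coe (ht i)]
  simp [t']

/-! ### The bound for the Legendre coefficients -/

lemma Psi_eq_prod {ν : ℕ →₀ ℕ} {m : ℕ} (hm : ν.support ⊆ Finset.range m) (y : Dom) :
    Psi ν y = ∏ i : Fin m, psi (ν i) (y i) := by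
  rw [Psi, ← Finset.prod_range (fun i => psi (ν i) (y i))]
  refine Finset.prod_subset hm fun i _ hi => ?_
  rw [Finsupp.notMem_support_iff.1 hi, psi_zero]

lemma continuous_Psi (ν : ℕ →₀ ℕ) : Continuous (Psi ν) := by
  unfold Psi
  refine continuous_finsetProd _ fun i _ => ?_
  have := continuous_psi (ν i)
  fun_prop

/-- The point of `ℂ^ℕ` with first coordinates `z` and the other coordinates of `y`. -/
def extend {m : ℕ} (y : Dom) (z : Fin m → ℂ) : ℕ → ℂ :=
  fun j => if h : j < m then z ⟨j, h⟩ else ((y j : ℝ) : ℂ)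

lemma extend_mem_polyellipse {m : ℕ} {ρ : ℕ → ℝ} (hρ : ∀ j, 1 ≤ ρ j) (y : Dom) {z : Fin m → ℂ}
    (hz : ∀ i : Fin m, z i ∈ ellipse (ρ i)) : extend y z ∈ polyellipse ρ := by
  intro j
  unfold extend
  split_ifs with h
  · exact hz ⟨j, h⟩
  · exact ofReal_mem_ellipse (hρ j) (y j).2

lemma extend_update {m : ℕ} (y : Dom) (z : Fin m → ℂ) (i : Fin m) (ζ : ℂ) :
    extend y (Function.update z i ζ) = Function.update (extend y z) i ζ := by
  ext j
  unfold extend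
  by_cases h : j = i
  · subst h; simp
  · rw [Function.update_of_ne h]
    split_ifs with hj
    · rw [Function.update_of_ne]
      intro e; exact h (by rw [← e])
    · rfl

lemma mem_region_of_mem_polyellipse {b ρ : ℕ → ℝ} (hρ : ∀ j, 1 ≤ ρ j)
    (hsum : Summable fun j => ((ρ j + (ρ j)⁻¹) / 2 - 1) * b j)
    (hle : ∑' j, ((ρ j + (ρ j)⁻¹) / 2 - 1) * b j ≤ 1) {z : ℕ → ℂ} (hz : z ∈ polyellipse ρ) :
    z ∈ region b 1 := ⟨ρ, hρ, hsum, hle, hz⟩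

lemma ofReal_mem_region (b : ℕ → ℝ) (y : Dom) : (fun j => ((y j : ℝ) : ℂ)) ∈ region b 1 :=
  ⟨fun _ => 1, fun _ => le_rfl, by simp, by simp,
    fun j => ofReal_mem_ellipse le_rfl (y j).2⟩

section Bound

variable {V W : Type*} [NormedAddCommGroup V] [NormedSpace ℝ V]
  [NormedAddCommGroup W] [NormedSpace ℂ W]

lemma norm_le_one_of_mem_holoClass {ι : V →ₗᵢ[ℝ] W} {b : ℕ → ℝ} {f : Dom → V}
    (hf : f ∈ holoClass ι b) (y : Dom) : ‖f y‖ ≤ 1 := by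
  obtain ⟨O, g, -, -, -, hfg, hg⟩ := hf
  rw [← ι.norm_map, ← hfg]
  exact hg _ (ofReal_mem_region b y)

lemma memLp_of_mem_holoClass {ι : V →ₗᵢ[ℝ] W} {b : ℕ → ℝ} {f : Dom → V}
    (hf : f ∈ holoClass ι b) (hm : AEStronglyMeasurable f unifDom) (p : ℝ≥0∞) :
    MemLp f p unifDom :=
  MemLp.of_bound hm 1 (ae_of_all _ (norm_le_one_of_mem_holoClass hf))

/-- For frozen `y`, the integral over the first `m` coordinates is a tensor product of uniform rules
applied to a separately holomorphic function. Passing to the boundary rules gives the bound for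
every `y`, and averaging over `y` preserves it. The isometry `ι` carries the estimate from `W` back
to `V`. -/
lemma norm_coeff_le [CompleteSpace V] [CompleteSpace W] {ι : V →ₗᵢ[ℝ] W} {b : ℕ → ℝ} {f : Dom → V} (hf : f ∈ holoClass ι b)
    (hm : AEStronglyMeasurable f unifDom) (ν : ℕ →₀ ℕ) {ρ : ℕ → ℝ} (hρ : ∀ j, 1 ≤ ρ j)
    (hν : ∀ j ∈ ν.support, 1 < ρ j)
    (hsum : Summable fun j => ((ρ j + (ρ j)⁻¹) / 2 - 1) * b j)
    (hle : ∑' j, ((ρ j + (ρ j)⁻¹) / 2 - 1) * b j ≤ 1) :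
    ‖coeff f ν‖ ≤ ∏ j ∈ ν.support, (2 * ρ j / (ρ j - 1) * (ρ j ^ ν j)⁻¹) := by
  obtain ⟨m, hm'⟩ : ∃ m, ν.support ⊆ Finset.range m := ν.support.exists_nat_subset_range
  have hfi : Integrable f unifDom := (memLp_of_mem_holoClass hf hm 1).integrable le_rfl
  obtain ⟨O, g, -, hO, hhol, hfg, hg⟩ := hf
  have hreg {z : ℕ → ℂ} (hz : z ∈ polyellipse ρ) : z ∈ region b 1 :=
    mem_region_of_mem_polyellipse hρ hsum hle hz
  have hsep (y : Dom) : SepHolo (fun i : Fin m => ellipse (ρ i)) fun z => g (extend y z) := by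
    refine ⟨fun z hz i => ?_, fun z hz => hg _ (hreg (extend_mem_polyellipse hρ y hz))⟩
    have := hhol _ (hO (hreg (extend_mem_polyellipse hρ y hz))) i
    simp only [extend_update]
    simpa [extend] using this
  let R : ∀ i : Fin m, CurveRule (ellipse (ρ i)) := fun i => unifRule (ν i) (ρ i) (hρ i)
  have hex : ∀ i : Fin m, _ := fun i =>
    exists_rule_bound (n := ν i) (hρ i) fun h => hν i (Finsupp.mem_support_iff.2 h)
  choose R' hR'b hR' using hex
  have hin (y : Dom) : ∫ x, ((Psi ν x : ℝ) : ℂ) • ι (f (mix m x y)) ∂unifDom =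
      CurveRule.multi R fun z => g (extend y z) := by
    rw [CurveRule.multi]
    change _ = ∫ x, _ ∂(Measure.pi fun _ : Fin m => unif.map Subtype.val)
    rw [← map_initial, integral_map (measurable_initial m).aemeasurable
      ((hsep y).stronglyMeasurable_integrand R).aestronglyMeasurable]
    refine integral_congr_ae (ae_of_all _ fun x => ?_)
    simp only [CurveRule.integrand, R, unifRule, initial, clamp_coe, ← hfg, Psi_eq_prod hm']
    push_cast
    congr 2
    ext j
    simp only [mix, extend]
    split_ifs <;> rfl
  have hbound (y : Dom) : ‖∫ x, ((Psi ν x : ℝ) : ℂ) • ι (f (mix m x y)) ∂unifDom‖ ≤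
      ∏ j ∈ ν.support, (2 * ρ j / (ρ j - 1) * (ρ j ^ ν j)⁻¹) := by
    rw [hin, (hsep y).multi_eq R R' fun i F hF => hR' i F hF]
    refine ((hsep y).norm_multi_le R').trans (le_of_eq ?_)
    simp only [hR'b]
    rw [← Finset.prod_range (fun i => if ν i = 0 then 1 else 2 * ρ i / (ρ i - 1) * (ρ i ^ ν i)⁻¹)]
    symm
    refine (Finset.prod_congr rfl fun i hi => ?_).trans (Finset.prod_subset hm' fun i _ hi => ?_)
    · rw [if_neg (Finsupp.mem_support_iff.1 hi)]
    · rw [if_pos (Finsupp.notMem_support_iff.1 hi)]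
  have hGi : Integrable (fun y => ((Psi ν y : ℝ) : ℂ) • ι (f y)) unifDom := by
    obtain ⟨C, hC⟩ := isCompact_univ.exists_bound_of_continuousOn (continuous_Psi ν).continuousOn
    refine (ι.toContinuousLinearMap.integrable_comp hfi).bdd_smul C ?_
      (ae_of_all _ fun y => ?_)
    · exact (Complex.continuous_ofReal.comp (continuous_Psi ν)).aestronglyMeasurable
    · simpa using hC y trivial
  have hcoef : ι (coeff f ν) = ∫ y, ((Psi ν y : ℝ) : ℂ) • ι (f y) ∂unifDom := by
    rw [coeff, ← LinearIsometry.coe_toContinuousLinearMap, ← ContinuousLinearMap.integral_comp_comm]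
    · simp
    · obtain ⟨C, hC⟩ := isCompact_univ.exists_bound_of_continuousOn (continuous_Psi ν).continuousOn
      exact hfi.bdd_smul C (continuous_Psi ν).aestronglyMeasurable (ae_of_all _ fun y => hC y trivial)
  have hmp := measurePreserving_mix m
  have hGi' : Integrable (fun q : Dom × Dom =>
      ((Psi ν (mix m q.1 q.2) : ℝ) : ℂ) • ι (f (mix m q.1 q.2))) (unifDom.prod unifDom) :=
    (hmp.integrable_comp hGi.aestronglyMeasurable).2 hGi
  rw [← ι.norm_map, hcoef, ← hmp.map_eq, integral_map hmp.measurable.aemeasurable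
    (by rw [hmp.map_eq]; exact hGi.aestronglyMeasurable),
    integral_prod_symm _ hGi']
  have hPsi : ∀ x y, Psi ν (mix m x y) = Psi ν x := by
    intro x y
    simp [Psi_eq_prod hm', mix]
  simp only [hPsi]
  simpa using norm_integral_le_of_norm_le_const (μ := unifDom) (ae_of_all _ hbound)

end Bound

/-! ### Sums over multi-indices -/

/-- The term `|n|! / n! * γ^n` of a multinomial series. -/
def multinomialTerm (γ : ℕ → ℝ) (n : ℕ →₀ ℕ) : ℝ :=
  ((∑ j ∈ n.support, n j).factorial : ℝ) / (∏ j ∈ n.support, ((n j).factorial : ℝ)) *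
    ∏ j ∈ n.support, γ j ^ n j

lemma multinomialTerm_nonneg {γ : ℕ → ℝ} (hγ : ∀ j, 0 ≤ γ j) (n : ℕ →₀ ℕ) :
    0 ≤ multinomialTerm γ n :=
  mul_nonneg (by positivity) (Finset.prod_nonneg fun j _ => pow_nonneg (hγ j) _)

lemma multinomialTerm_eq (γ : ℕ → ℝ) {n : ℕ →₀ ℕ} {s : Finset ℕ} (hs : n.support ⊆ s) :
    multinomialTerm γ n = Nat.multinomial s n * ∏ j ∈ s, γ j ^ n j := by
  have h0 : ∀ j ∈ s, j ∉ n.support → n j = 0 := fun j _ hj => Finsupp.notMem_support_iff.1 hj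
  have hspec : (∏ j ∈ s, ((n j).factorial : ℝ)) * (Nat.multinomial s n : ℝ) =
      ((∑ j ∈ s, n j).factorial : ℝ) := by exact_mod_cast Nat.multinomial_spec s n
  have h1 : ∑ j ∈ n.support, n j = ∑ j ∈ s, n j :=
    Finset.sum_subset hs h0
  have h2 : ∏ j ∈ n.support, ((n j).factorial : ℝ) = ∏ j ∈ s, ((n j).factorial : ℝ) :=
    Finset.prod_subset hs fun j hj hj' => by simp [h0 j hj hj']
  have h3 : ∏ j ∈ n.support, γ j ^ n j = ∏ j ∈ s, γ j ^ n j :=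
    Finset.prod_subset hs fun j hj hj' => by simp [h0 j hj hj']
  have hpos : ∏ j ∈ s, ((n j).factorial : ℝ) ≠ 0 :=
    Finset.prod_ne_zero_iff.2 fun j _ => by exact_mod_cast Nat.factorial_ne_zero _
  rw [multinomialTerm, h1, h2, h3, ← hspec, mul_div_cancel_left₀ _ hpos]

/-- Grouped by total degree `k`, any finite partial sum is at most `∑ Γ^k` by the multinomial
theorem, and `Γ < 1`. -/
lemma summable_multinomialTerm {γ : ℕ → ℝ} (hγ : ∀ j, 0 ≤ γ j) (hs : Summable γ)
    (h1 : ∑' j, γ j < 1) : Summable (multinomialTerm γ) := by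
  classical
  set Γ := ∑' j, γ j
  have hΓ : 0 ≤ Γ := tsum_nonneg hγ
  refine summable_of_sum_le (c := (1 - Γ)⁻¹) (multinomialTerm_nonneg hγ) fun T => ?_
  set s : Finset ℕ := T.biUnion fun n => n.support with hsdef
  have hsub : ∀ n ∈ T, n.support ⊆ s := fun n hn => Finset.subset_biUnion_of_mem _ hn
  set N := T.sup fun n => ∑ j ∈ s, n j
  have hmaps : ∀ n ∈ T, ∑ j ∈ s, n j ∈ Finset.range (N + 1) := fun n hn =>
    Finset.mem_range.2 (Nat.lt_succ_of_le (Finset.le_sup (f := fun n : ℕ →₀ ℕ => ∑ j ∈ s, n j) hn))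
  rw [← Finset.sum_fiberwise_of_maps_to hmaps]
  calc ∑ k ∈ Finset.range (N + 1), ∑ n ∈ T with ∑ j ∈ s, n j = k, multinomialTerm γ n
      ≤ ∑ k ∈ Finset.range (N + 1), Γ ^ k := by
        refine Finset.sum_le_sum fun k _ => ?_
        calc ∑ n ∈ T with ∑ j ∈ s, n j = k, multinomialTerm γ n
            = ∑ n ∈ T with ∑ j ∈ s, n j = k,
                (fun f : ℕ → ℕ => (Nat.multinomial s f : ℝ) * ∏ j ∈ s, γ j ^ f j) n :=
              Finset.sum_congr rfl fun n hn =>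
                multinomialTerm_eq γ (hsub n (Finset.mem_filter.1 hn).1)
          _ = ∑ f ∈ (T.filter fun n => ∑ j ∈ s, n j = k).image (fun n : ℕ →₀ ℕ => (n : ℕ → ℕ)),
                (Nat.multinomial s f : ℝ) * ∏ j ∈ s, γ j ^ f j := by
              rw [Finset.sum_image]
              intro n _ n' _ h
              exact DFunLike.coe_injective h
          _ ≤ ∑ f ∈ s.piAntidiag k, (Nat.multinomial s f : ℝ) * ∏ j ∈ s, γ j ^ f j := by
              refine Finset.sum_le_sum_of_subset_of_nonneg ?_ fun f _ _ =>
                mul_nonneg (Nat.cast_nonneg _) (Finset.prod_nonneg fun j _ => pow_nonneg (hγ j) _)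
              intro f hf
              obtain ⟨n, hn, rfl⟩ := Finset.mem_image.1 hf
              obtain ⟨hnT, hnk⟩ := Finset.mem_filter.1 hn
              exact Finset.mem_piAntidiag.2
                ⟨hnk, fun j hj => hsub n hnT (Finsupp.mem_support_iff.2 hj)⟩
          _ = (∑ j ∈ s, γ j) ^ k := (Finset.sum_pow_eq_sum_piAntidiag s γ k).symm
          _ ≤ Γ ^ k := pow_le_pow_left₀ (Finset.sum_nonneg fun j _ => hγ j)
              (hs.sum_le_tsum s fun j _ => hγ j) k
    _ ≤ ∑' k, Γ ^ k := (summable_geometric_of_lt_one hΓ h1).sum_le_tsum _ fun k _ => pow_nonneg hΓ k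
    _ = (1 - Γ)⁻¹ := tsum_geometric_of_lt_one hΓ h1

lemma summable_prod_pow (J : ℕ) {x : ℝ} (hx : 0 ≤ x) (h1 : x < 1) :
    Summable fun a : Fin J → ℕ => ∏ i, x ^ a i := by
  refine summable_of_sum_le (c := ((1 - x)⁻¹) ^ J)
    (fun a => Finset.prod_nonneg fun i _ => pow_nonneg hx _) fun T => ?_
  set N := T.sup fun a => ∑ i, a i
  calc ∑ a ∈ T, ∏ i, x ^ a i
      ≤ ∑ a ∈ Fintype.piFinset fun _ : Fin J => Finset.range (N + 1), ∏ i, x ^ a i := by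
        refine Finset.sum_le_sum_of_subset_of_nonneg (fun a ha => ?_) fun a _ _ =>
          Finset.prod_nonneg fun i _ => pow_nonneg hx _
        refine Fintype.mem_piFinset.2 fun i => Finset.mem_range.2 (Nat.lt_succ_of_le ?_)
        exact (Finset.single_le_sum (fun _ _ => Nat.zero_le _) (Finset.mem_univ i)).trans
          (Finset.le_sup (f := fun a : Fin J → ℕ => ∑ i, a i) ha)
    _ = ∏ _i : Fin J, ∑ k ∈ Finset.range (N + 1), x ^ k := (Finset.prod_univ_sum _ _).symm
    _ ≤ ((1 - x)⁻¹) ^ J := by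
        rw [Finset.prod_const, Finset.card_univ, Fintype.card_fin]
        refine pow_le_pow_left₀ (Finset.sum_nonneg fun k _ => pow_nonneg hx k) ?_ J
        rw [← tsum_geometric_of_lt_one hx h1]
        exact (summable_geometric_of_lt_one hx h1).sum_le_tsum _ fun k _ => pow_nonneg hx k

/-- The entries of a multi-index from the position `J` on. -/
def tailIndex (J : ℕ) (ν : ℕ →₀ ℕ) : ℕ →₀ ℕ := ν.filter (J ≤ ·)

/-- A multi-index is determined by its first `J` entries and its tail, so the family is an injective
reindexing of part of a summable product family. -/
lemma summable_prod_mul_tail (J : ℕ) {u : (Fin J → ℕ) → ℝ} {v : (ℕ →₀ ℕ) → ℝ}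
    (hu : Summable u) (hv : Summable v) (hu0 : ∀ a, 0 ≤ u a) (hv0 : ∀ n, 0 ≤ v n) :
    Summable fun ν : ℕ →₀ ℕ => u (fun i => ν i) * v (tailIndex J ν) := by
  have h := hu.mul_of_nonneg hv hu0 hv0
  refine h.comp_injective (i := fun ν : ℕ →₀ ℕ => ((fun i : Fin J => ν i), tailIndex J ν)) ?_
  intro ν μ e
  obtain ⟨e1, e2⟩ := Prod.mk.inj e
  ext j
  by_cases hj : j < J
  · exact congrFun e1 ⟨j, hj⟩
  · have := DFunLike.congr_fun e2 j
    simpa [tailIndex, Finsupp.filter_apply, not_lt.1 hj] using this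

/-! ### Summability of the coefficient bounds -/

/-- The bound for the Legendre coefficients. -/
def coeffBound (K κ : ℝ) (J : ℕ) (α : ℕ → ℝ) (ν : ℕ →₀ ℕ) : ℝ :=
  K ^ J * (∏ i : Fin J, κ⁻¹ ^ ν i) * multinomialTerm α (tailIndex J ν)

lemma one_le_multinomial (n : ℕ →₀ ℕ) :
    (1 : ℝ) ≤ ((∑ j ∈ n.support, n j).factorial : ℝ) /
      (∏ j ∈ n.support, ((n j).factorial : ℝ)) := by
  rw [one_le_div (by positivity)]
  exact_mod_cast Nat.le_of_dvd (Nat.factorial_pos _) (Nat.prod_factorial_dvd_factorial_sum _ _)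

/-- A multinomial coefficient is at least one, so a power with exponent below one does not increase
it. -/
lemma multinomialTerm_rpow_le {p : ℝ} (hp0 : 0 < p) (hp1 : p < 1) {α : ℕ → ℝ}
    (hα : ∀ j, 0 ≤ α j) (n : ℕ →₀ ℕ) :
    multinomialTerm α n ^ p ≤ multinomialTerm (fun j => α j ^ p) n := by
  have h1 := one_le_multinomial n
  rw [multinomialTerm, multinomialTerm, Real.mul_rpow (by linarith)
    (Finset.prod_nonneg fun j _ => pow_nonneg (hα j) _),
    ← Real.finsetProd_rpow _ _ fun j _ => pow_nonneg (hα j) _]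
  have e : ∀ j, (α j ^ n j) ^ p = (α j ^ p) ^ n j := fun j => by
    rw [Real.rpow_pow_comm (hα j)]
  simp only [e]
  refine mul_le_mul_of_nonneg_right ?_
    (Finset.prod_nonneg fun j _ => pow_nonneg (Real.rpow_nonneg (hα j) _) _)
  calc _ ≤ (((∑ j ∈ n.support, n j).factorial : ℝ) /
        (∏ j ∈ n.support, ((n j).factorial : ℝ))) ^ (1 : ℝ) :=
        Real.rpow_le_rpow_of_exponent_le h1 hp1.le
    _ = _ := Real.rpow_one _

lemma summable_coeffBound_rpow {p : ℝ} (hp0 : 0 < p) (hp1 : p < 1) {K κ : ℝ} (hK : 0 ≤ K)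
    (hκ : 1 < κ) (J : ℕ) {α : ℕ → ℝ} (hα : ∀ j, 0 ≤ α j) (hs : Summable fun j => α j ^ p)
    (hJ : ∑' j, α (j + J) ^ p < 1) : Summable fun ν => coeffBound K κ J α ν ^ p := by
  -- Cutting off the indices below `J` brings the sum below one and loses nothing, since tail
  -- indices vanish there.
  set γ : ℕ → ℝ := fun j => if J ≤ j then α j ^ p else 0 with hγdef
  have hγ : ∀ j, 0 ≤ γ j := fun j => by
    simp only [hγdef]; split_ifs; exacts [Real.rpow_nonneg (hα j) _, le_rfl]
  have hγs : Summable γ := hs.of_nonneg_of_le hγ fun j => by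
    simp only [hγdef]; split_ifs; exacts [le_rfl, Real.rpow_nonneg (hα j) _]
  have hγ1 : ∑' j, γ j < 1 := by
    rw [← hγs.sum_add_tsum_nat_add J, Finset.sum_eq_zero, zero_add]
    · simpa [hγdef] using hJ
    · intro j hj
      simp [hγdef, Finset.mem_range.1 hj]
  have hκ1 : (κ⁻¹) ^ p < 1 :=
    Real.rpow_lt_one (by positivity) (inv_lt_one_of_one_lt₀ hκ) hp0
  have hκ0 : 0 ≤ (κ⁻¹) ^ p := by positivity
  have hsum := (summable_prod_mul_tail J (summable_prod_pow J hκ0 hκ1)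
    (summable_multinomialTerm hγ hγs hγ1) (fun a => Finset.prod_nonneg fun i _ => pow_nonneg hκ0 _)
    (multinomialTerm_nonneg hγ)).mul_left ((K ^ J) ^ p)
  have hκi : 0 ≤ κ⁻¹ := by positivity
  have hprod (ν : ℕ →₀ ℕ) : 0 ≤ ∏ i : Fin J, κ⁻¹ ^ ν i :=
    Finset.prod_nonneg fun i _ => pow_nonneg hκi _
  refine hsum.of_nonneg_of_le (fun ν => Real.rpow_nonneg (mul_nonneg (mul_nonneg (by positivity)
    (hprod ν)) (multinomialTerm_nonneg hα _)) _) fun ν => ?_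
  rw [coeffBound, Real.mul_rpow (mul_nonneg (by positivity) (hprod ν))
    (multinomialTerm_nonneg hα _), Real.mul_rpow (by positivity) (hprod ν), mul_assoc]
  refine mul_le_mul_of_nonneg_left ?_ (by positivity)
  rw [← Real.finsetProd_rpow _ _ fun i _ => pow_nonneg hκi _]
  have e : ∀ i : Fin J, (κ⁻¹ ^ ν i) ^ p = (κ⁻¹ ^ p) ^ ν i := fun i => by
    rw [Real.rpow_pow_comm hκi]
  simp only [e]
  refine mul_le_mul_of_nonneg_left ?_ (Finset.prod_nonneg fun i _ => pow_nonneg hκ0 _)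
  refine (multinomialTerm_rpow_le hp0 hp1 hα _).trans (le_of_eq ?_)
  rw [multinomialTerm, multinomialTerm]
  congr 1
  refine Finset.prod_congr rfl fun j hj => ?_
  have hj' : J ≤ j := by
    by_contra h
    exact Finsupp.mem_support_iff.1 hj (by simp [tailIndex, h])
  simp [hγdef, hj']

/-! ### The choice of the polyellipse -/

/-- The factor one half lets the `κ` part and the adapted part of the radii share the budget. -/
lemma half_add_inv_sub_one_le {ρ : ℝ} (hρ : 1 ≤ ρ) : (ρ + ρ⁻¹) / 2 - 1 ≤ (ρ - 1) / 2 := by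
  have := inv_le_one_of_one_le₀ hρ
  linarith

lemma two_mul_div_sub_one_le {κ ρ : ℝ} (hκ : 1 < κ) (h : κ ≤ ρ) :
    2 * ρ / (ρ - 1) ≤ 2 * κ / (κ - 1) := by
  rw [div_le_div_iff₀ (by linarith) (by linarith)]
  nlinarith

/-- `n^n / n!` is a single term of the series of `e^n`. -/
lemma pow_self_le_exp_mul_factorial (n : ℕ) :
    (n : ℝ) ^ n ≤ Real.exp 1 ^ n * (n.factorial : ℝ) := by
  have h := Real.pow_div_factorial_le_exp (x := n) (Nat.cast_nonneg n) n
  rw [div_le_iff₀ (by exact_mod_cast Nat.factorial_pos n)] at h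
  rwa [← Real.exp_nat_mul, mul_one]

/-- With `A = |n|`, the product contains `A^A / ∏ n_j^(n_j)`, and `A^A ≤ e^A A!` while `n_j! ≤
n_j^(n_j)`. On the support `n_j ≥ 1`, so each constant `K` is absorbed into `K^(n_j)`. -/
lemma prod_tail_le {K : ℝ} (hK : 1 ≤ K) {b : ℕ → ℝ} (hb : ∀ j, 0 < b j) (n : ℕ →₀ ℕ) :
    ∏ j ∈ n.support, (K * ((n j / ((∑ i ∈ n.support, n i : ℕ) * b j)) ^ n j)⁻¹) ≤
      multinomialTerm (fun j => Real.exp 1 * K * b j) n := by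
  set A := ∑ i ∈ n.support, n i with hA
  have hterm : ∀ j ∈ n.support, K * (((n j : ℝ) / (A * b j)) ^ n j)⁻¹ ≤
      (K * b j) ^ n j * ((A : ℝ) ^ n j * ((n j : ℝ) ^ n j)⁻¹) := by
    intro j hj
    have hj0 : n j ≠ 0 := Finsupp.mem_support_iff.1 hj
    have hbj := hb j
    calc K * (((n j : ℝ) / (A * b j)) ^ n j)⁻¹
        ≤ K ^ n j * (((n j : ℝ) / (A * b j)) ^ n j)⁻¹ :=
          mul_le_mul_of_nonneg_right (le_self_pow₀ hK hj0) (by positivity)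
      _ = _ := by
          rw [← inv_pow, inv_div, div_pow, mul_pow, mul_pow]
          ring
  have hK0 : 0 ≤ K := by linarith
  calc _ ≤ ∏ j ∈ n.support, ((K * b j) ^ n j * ((A : ℝ) ^ n j * ((n j : ℝ) ^ n j)⁻¹)) :=
        Finset.prod_le_prod (fun j _ => by have := (hb j).le; positivity) hterm
    _ = (A : ℝ) ^ A * (∏ j ∈ n.support, (n j : ℝ) ^ n j)⁻¹ * ∏ j ∈ n.support, (K * b j) ^ n j := by
        rw [Finset.prod_mul_distrib, Finset.prod_mul_distrib, Finset.prod_pow_eq_pow_sum,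
          Finset.prod_inv_distrib]
        ring
    _ ≤ (Real.exp 1 ^ A * (A.factorial : ℝ)) * (∏ j ∈ n.support, ((n j).factorial : ℝ))⁻¹ *
          ∏ j ∈ n.support, (K * b j) ^ n j := by
        refine mul_le_mul_of_nonneg_right ?_
          (Finset.prod_nonneg fun j _ => pow_nonneg (mul_nonneg hK0 (hb j).le) _)
        refine mul_le_mul (pow_self_le_exp_mul_factorial A) ?_ (by positivity) (by positivity)
        refine inv_anti₀ (by positivity) (Finset.prod_le_prod (fun _ _ => by positivity) ?_)
        exact fun j _ => by exact_mod_cast Nat.factorial_le_pow (n j)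
    _ = multinomialTerm (fun j => Real.exp 1 * K * b j) n := by
        rw [multinomialTerm, ← hA]
        simp only [mul_assoc (Real.exp 1), mul_pow (Real.exp 1), Finset.prod_mul_distrib,
          Finset.prod_pow_eq_pow_sum]
        rw [← hA]
        ring

/-- The radii of a polyellipse that is adapted to the multi-index `ν`. -/
def radii (κ : ℝ) (J : ℕ) (b : ℕ → ℝ) (ν : ℕ →₀ ℕ) (j : ℕ) : ℝ :=
  if j ∈ ν.support then
    κ + (tailIndex J ν j : ℝ) /
      ((∑ i ∈ (tailIndex J ν).support, tailIndex J ν i : ℕ) * b j) else 1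

lemma radii_ge {κ : ℝ} (J : ℕ) {b : ℕ → ℝ} (hb : ∀ j, 0 < b j) (ν : ℕ →₀ ℕ) {j : ℕ} (hj : j ∈ ν.support) : κ ≤ radii κ J b ν j := by
  rw [radii, if_pos hj]
  have := hb j
  exact le_add_of_nonneg_right (by positivity)

lemma one_le_radii {κ : ℝ} (hκ : 1 < κ) (J : ℕ) {b : ℕ → ℝ} (hb : ∀ j, 0 < b j)
    (ν : ℕ →₀ ℕ) (j : ℕ) : 1 ≤ radii κ J b ν j := by
  by_cases hj : j ∈ ν.support
  · exact hκ.le.trans (radii_ge J hb ν hj)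
  · rw [radii, if_neg hj]

/-- Minimizing `∏ ρ_j^(-n_j)` with `∑ ρ_j b_j` fixed makes `ρ_j b_j` proportional to `n_j`, whence
the form of the radii. The shares `n_j / |n|` sum to at most one (to zero for an empty tail), `(κ-1)
∑ b_j ≤ 1`, and half of the total fits the budget. Radii off the support equal one and cost nothing.
-/
lemma radii_budget {κ : ℝ} (hκ : 1 < κ) (J : ℕ) {b : ℕ → ℝ} (hb : ∀ j, 0 < b j)
    (ν : ℕ →₀ ℕ) (hs : Summable b) (hκb : (κ - 1) * ∑' j, b j ≤ 1) :
    Summable (fun j => ((radii κ J b ν j + (radii κ J b ν j)⁻¹) / 2 - 1) * b j) ∧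
      ∑' j, ((radii κ J b ν j + (radii κ J b ν j)⁻¹) / 2 - 1) * b j ≤ 1 := by
  have h0 : ∀ j ∉ ν.support, ((radii κ J b ν j + (radii κ J b ν j)⁻¹) / 2 - 1) * b j = 0 := by
    intro j hj
    rw [radii, if_neg hj]; norm_num
  refine ⟨summable_of_ne_finset_zero h0, ?_⟩
  rw [tsum_eq_sum h0]
  set n := tailIndex J ν with hn
  set A := ∑ i ∈ n.support, n i with hA
  have hle : ∀ j ∈ ν.support, ((radii κ J b ν j + (radii κ J b ν j)⁻¹) / 2 - 1) * b j ≤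
      ((κ - 1) * b j + (n j : ℝ) / A) / 2 := by
    intro j hj
    have hbj := hb j
    refine (mul_le_mul_of_nonneg_right (half_add_inv_sub_one_le (one_le_radii hκ J hb ν j))
      hbj.le).trans (le_of_eq ?_)
    rw [radii, if_pos hj, ← hn, ← hA, ← div_div]
    field_simp
    ring
  have hsub : n.support ⊆ ν.support := by
    intro j hj
    rw [Finsupp.mem_support_iff] at hj ⊢
    intro h
    exact hj (by simp [hn, tailIndex, Finsupp.filter_apply, h])
  have hsum : ∑ j ∈ ν.support, (n j : ℝ) / A ≤ 1 := by
    rw [← Finset.sum_div]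
    have : ∑ j ∈ ν.support, (n j : ℝ) = A := by
      rw [hA]; push_cast
      exact (Finset.sum_subset hsub fun j _ hj => by
        rw [Finsupp.notMem_support_iff.1 hj, Nat.cast_zero]).symm
    rw [this]
    exact div_self_le_one _
  have hbsum : ∑ j ∈ ν.support, (κ - 1) * b j ≤ 1 := by
    rw [← Finset.mul_sum]
    exact (mul_le_mul_of_nonneg_left (hs.sum_le_tsum _ fun j _ => (hb j).le) (by linarith)).trans hκb
  calc _ ≤ ∑ j ∈ ν.support, ((κ - 1) * b j + (n j : ℝ) / A) / 2 := Finset.sum_le_sum hle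
    _ = (∑ j ∈ ν.support, (κ - 1) * b j + ∑ j ∈ ν.support, (n j : ℝ) / A) / 2 := by
        rw [← Finset.sum_div, Finset.sum_add_distrib]
    _ ≤ 1 := by linarith

/-- All radii on the support are at least `κ`, so `K` bounds the factors `2ρ/(ρ-1)`. Below `J` the
radius is estimated by `κ`, from `J` on by its adapted part alone. -/
lemma prod_radii_le {κ : ℝ} (hκ : 1 < κ) (J : ℕ) {b : ℕ → ℝ} (hb : ∀ j, 0 < b j)
    (ν : ℕ →₀ ℕ) :
    ∏ j ∈ ν.support, (2 * radii κ J b ν j / (radii κ J b ν j - 1) * (radii κ J b ν j ^ ν j)⁻¹) ≤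
      coeffBound (2 * κ / (κ - 1)) κ J (fun j => Real.exp 1 * (2 * κ / (κ - 1)) * b j) ν := by
  set K := 2 * κ / (κ - 1) with hKdef
  have hκ1 : 0 < κ - 1 := by linarith
  have hK : 1 ≤ K := by rw [hKdef, one_le_div hκ1]; linarith
  have hK0 : 0 ≤ K := by linarith
  set n := tailIndex J ν with hn
  have hterm : ∀ j ∈ ν.support,
      2 * radii κ J b ν j / (radii κ J b ν j - 1) * (radii κ J b ν j ^ ν j)⁻¹ ≤
        K * (radii κ J b ν j ^ ν j)⁻¹ := fun j hj =>
    mul_le_mul_of_nonneg_right (two_mul_div_sub_one_le hκ (radii_ge J hb ν hj))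
      (inv_nonneg.2 (pow_nonneg (by linarith [one_le_radii hκ J hb ν j]) _))
  have hpos : ∀ j, 0 < radii κ J b ν j := fun j => by linarith [one_le_radii hκ J hb ν j]
  refine (Finset.prod_le_prod (fun j hj => ?_) hterm).trans ?_
  · have h1 := hκ.trans_le (radii_ge J hb ν hj)
    have h2 : 0 < radii κ J b ν j - 1 := by linarith
    have h3 := hpos j
    positivity
  rw [← Finset.prod_filter_mul_prod_filter_not ν.support (· < J), coeffBound]
  refine mul_le_mul ?_ ?_ (Finset.prod_nonneg fun j _ => by have := hpos j; positivity)
    (by positivity)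
  · calc _ ≤ ∏ j ∈ ν.support with j < J, K * κ⁻¹ ^ ν j := by
          refine Finset.prod_le_prod (fun j _ => by have := hpos j; positivity) fun j hj => ?_
          rw [inv_pow]
          refine mul_le_mul_of_nonneg_left (inv_anti₀ (by positivity) ?_) hK0
          exact pow_le_pow_left₀ (by linarith) (radii_ge J hb ν (Finset.mem_filter.1 hj).1) _
      _ ≤ ∏ j ∈ Finset.range J, K * κ⁻¹ ^ ν j := by
          have hsub : ν.support.filter (· < J) ⊆ Finset.range J := fun j hj =>
            Finset.mem_range.2 (Finset.mem_filter.1 hj).2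
          rw [Finset.prod_mul_distrib, Finset.prod_mul_distrib, Finset.prod_const,
            Finset.prod_const]
          have h1 : ∏ j ∈ ν.support with j < J, κ⁻¹ ^ ν j = ∏ j ∈ Finset.range J, κ⁻¹ ^ ν j := by
            refine Finset.prod_subset hsub fun j hj hj' => ?_
            have : ν j = 0 := by
              by_contra h
              exact hj' (Finset.mem_filter.2 ⟨Finsupp.mem_support_iff.2 h, Finset.mem_range.1 hj⟩)
            rw [this, pow_zero]
          rw [h1]
          exact mul_le_mul_of_nonneg_right (pow_le_pow_right₀ hK (Finset.card_le_card hsub))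
            (by positivity)
      _ = K ^ J * ∏ i : Fin J, κ⁻¹ ^ ν i := by
          rw [Finset.prod_mul_distrib, Finset.prod_const, Finset.card_range, Finset.prod_range]
  · have hsupp : ν.support.filter (fun j => ¬ j < J) = n.support := by
      ext j
      simp only [Finset.mem_filter, Finsupp.mem_support_iff, hn, tailIndex, Finsupp.filter_apply,
        not_lt]
      split_ifs with h <;> simp [h]
    rw [hsupp]
    refine le_trans (Finset.prod_le_prod (fun j _ => by have := hpos j; positivity)
      fun j hj => ?_) (prod_tail_le hK hb n)
    have hjJ := hsupp ▸ hj
    obtain ⟨hj1, hj2⟩ := Finset.mem_filter.1 hjJ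
    have hnj : n j = ν j := by simp [hn, tailIndex, not_lt.1 hj2]
    have hbj := hb j
    have hn0 : 0 < n j := Nat.pos_of_ne_zero (Finsupp.mem_support_iff.1 hj)
    have hA0 : 0 < ∑ i ∈ n.support, n i := hn0.trans_le (Finset.single_le_sum
      (fun _ _ => Nat.zero_le _) hj)
    rw [← hnj]
    refine mul_le_mul_of_nonneg_left (inv_anti₀ (by positivity) ?_) hK0
    refine pow_le_pow_left₀ (by positivity) ?_ _
    rw [radii, if_pos hj1]
    exact le_add_of_nonneg_left (by linarith)

/-- There are `p`-summable bounds for the Legendre coefficients of the functions in the class. -/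
lemma exists_coeff_bound {b : ℕ → ℝ} (hb : ∀ j, 0 < b j) {p : ℝ} (hp0 : 0 < p) (hp1 : p < 1)
    (hbp : Summable fun j => b j ^ p) :
    ∃ B : (ℕ →₀ ℕ) → ℝ, Summable (fun ν => B ν ^ p) ∧
      ∀ ν, 0 ≤ B ν ∧ ∃ ρ : ℕ → ℝ, (∀ j, 1 ≤ ρ j) ∧ (∀ j ∈ ν.support, 1 < ρ j) ∧
        Summable (fun j => ((ρ j + (ρ j)⁻¹) / 2 - 1) * b j) ∧
        ∑' j, ((ρ j + (ρ j)⁻¹) / 2 - 1) * b j ≤ 1 ∧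
        ∏ j ∈ ν.support, (2 * ρ j / (ρ j - 1) * (ρ j ^ ν j)⁻¹) ≤ B ν := by
  -- All but finitely many `b j` are at most one, and there `b j ≤ b j ^ p`.
  have hbs : Summable b := by
    have hlt := hbp.tendsto_cofinite_zero.eventually (gt_mem_nhds zero_lt_one)
    refine Summable.of_norm_bounded_eventually hbp ?_
    filter_upwards [hlt] with j hj
    rw [Real.norm_of_nonneg (hb j).le]
    have hb1 : b j ≤ 1 := by
      by_contra h
      exact absurd (Real.one_lt_rpow (not_le.1 h) hp0) (not_lt.2 hj.le)
    calc b j = b j ^ (1 : ℝ) := (Real.rpow_one _).symm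
      _ ≤ b j ^ p := Real.rpow_le_rpow_of_exponent_ge (hb j) hb1 hp1.le
  set bs := ∑' j, b j
  have hbs0 : 0 ≤ bs := tsum_nonneg fun j => (hb j).le
  set κ : ℝ := 1 + (1 + bs)⁻¹ with hκdef
  have hκ : 1 < κ := by rw [hκdef]; exact lt_add_of_pos_right _ (by positivity)
  have hκb : (κ - 1) * bs ≤ 1 := by
    rw [hκdef, add_sub_cancel_left, inv_mul_le_iff₀ (by positivity)]; linarith
  set K := 2 * κ / (κ - 1) with hK
  have hκ1 : 0 < κ - 1 := by linarith
  have hK0 : 0 ≤ K := by positivity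
  set α : ℕ → ℝ := fun j => Real.exp 1 * K * b j with hαdef
  have hα : ∀ j, 0 ≤ α j := fun j => by have := (hb j).le; positivity
  have hαs : Summable fun j => α j ^ p := by
    have : ∀ j, α j ^ p = (Real.exp 1 * K) ^ p * b j ^ p := fun j =>
      Real.mul_rpow (by positivity) (hb j).le
    simp only [this]
    exact hbp.mul_left _
  -- The order of choices matters: `κ` fixes `K`, hence `α`, and only then is `J` taken large.
  obtain ⟨J, hJ⟩ : ∃ J, ∑' j, α (j + J) ^ p < 1 :=
    ((tendsto_sum_nat_add fun j => α j ^ p).eventually (gt_mem_nhds zero_lt_one)).exists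
  refine ⟨coeffBound K κ J α, summable_coeffBound_rpow hp0 hp1 hK0 hκ J hα hαs hJ, fun ν => ?_⟩
  have hB : 0 ≤ coeffBound K κ J α ν :=
    mul_nonneg (by positivity) (multinomialTerm_nonneg hα _)
  obtain ⟨h1, h2⟩ := radii_budget hκ J hb ν hbs hκb
  exact ⟨hB, radii κ J b ν, one_le_radii hκ J hb ν, fun j hj => hκ.trans_le (radii_ge J hb ν hj),
    h1, h2, prod_radii_le hκ J hb ν⟩

/-! ### Best approximation of `p`-summable families -/

lemma sub_restr_apply {I V : Type*} [NormedAddCommGroup V] (c : I → V) (S : Finset I) (i : I) :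
    (c - restr c S) i = (S : Set I)ᶜ.indicator c i := by
  by_cases h : i ∈ S <;> simp [restr, h]

/-- The indices of the large members of a `p`-summable family. -/
lemma exists_finset_small {I : Type*} [Infinite I] {B : I → ℝ} {p : ℝ}
    (hB : ∀ i, 0 ≤ B i) (hs : Summable fun i => B i ^ p) {s : ℕ} (h1 : 1 ≤ s) :
    ∃ S : Finset I, S.card = s ∧ ∀ i ∉ S, B i ^ p ≤ (1 + ∑' i, B i ^ p) / s := by
  -- The added `1` makes the threshold `A / s` positive, so only finitely many indices reach it; by
  -- counting, at most `s`.
  set A := 1 + ∑' i, B i ^ p with hA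
  have hA0 : 0 < A := by
    have : 0 ≤ ∑' i, B i ^ p := tsum_nonneg fun i => Real.rpow_nonneg (hB i) _
    linarith
  have hs0 : (0 : ℝ) < s := by exact_mod_cast h1
  have hfin : {i | ¬ B i ^ p < A / s}.Finite :=
    hs.tendsto_cofinite_zero.eventually (gt_mem_nhds (div_pos hA0 hs0))
  have hcard : hfin.toFinset.card ≤ s := by
    have h2 : (hfin.toFinset.card : ℝ) * (A / s) ≤ A := by
      calc (hfin.toFinset.card : ℝ) * (A / s) = ∑ i ∈ hfin.toFinset, A / s := by
            rw [Finset.sum_const, nsmul_eq_mul]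
        _ ≤ ∑ i ∈ hfin.toFinset, B i ^ p := Finset.sum_le_sum fun i hi =>
            not_lt.1 (hfin.mem_toFinset.1 hi)
        _ ≤ ∑' i, B i ^ p := hs.sum_le_tsum _ fun i _ => Real.rpow_nonneg (hB i) _
        _ ≤ A := by rw [hA]; linarith
    rw [mul_div_assoc', div_le_iff₀ hs0, mul_comm] at h2
    exact_mod_cast le_of_mul_le_mul_left h2 hA0
  -- The set is filled up to exactly `s` elements, since `bestL2Error` ranges over sets of that
  -- size.
  obtain ⟨S, hS, hSc⟩ := Infinite.exists_superset_card_eq hfin.toFinset s hcard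
  refine ⟨S, hSc, fun i hi => ?_⟩
  by_contra h
  exact hi (hS (hfin.mem_toFinset.2 fun h' => h h'.le))

/-- Stechkin's inequality. -/
lemma ellNorm_sub_restr_le {I V : Type*} [NormedAddCommGroup V] {B : I → ℝ} {p : ℝ} (hp0 : 0 < p)
    (hB : ∀ i, 0 ≤ B i) (hs : Summable fun i => B i ^ p) {s : ℕ} (h1 : 1 ≤ s) {S : Finset I}
    (hS : ∀ i ∉ S, B i ^ p ≤ (1 + ∑' i, B i ^ p) / s) {c : I → V} (hc : ∀ i, ‖c i‖ ≤ B i)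
    {q : ℝ} (hpq : p ≤ q) :
    ellNorm q (c - restr c S) ≤
      ENNReal.ofReal ((1 + ∑' i, B i ^ p) ^ (1 / p) * (s : ℝ) ^ (1 / q - 1 / p)) := by
  set A := 1 + ∑' i, B i ^ p with hA
  have hA1 : 0 ≤ ∑' i, B i ^ p := tsum_nonneg fun i => Real.rpow_nonneg (hB i) _
  have hA0 : 0 < A := by linarith
  have hs0 : (0 : ℝ) < s := by exact_mod_cast h1
  have hq0 : 0 < q := hp0.trans_le hpq
  -- Off `S`, `B^q = B^p * (B^p)^((q-p)/p) ≤ B^p * D`, and `(A * D)^(1/q) = A^(1/p) * s^(1/q -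
  -- 1/p)`.
  set D := (A / s) ^ ((q - p) / p) with hD
  have hD0 : 0 ≤ D := by positivity
  have hterm : ∀ i, ‖(c - restr c S) i‖ₑ ^ q ≤ ENNReal.ofReal (B i ^ p * D) := by
    intro i
    rw [sub_restr_apply]
    by_cases hi : i ∈ S
    · simp [hi, hq0]
    · rw [Set.indicator_of_mem (by simpa using hi), ← ofReal_norm,
        ENNReal.ofReal_rpow_of_nonneg (norm_nonneg _) hq0.le]
      refine ENNReal.ofReal_le_ofReal ?_
      have hBp : 0 ≤ B i ^ p := Real.rpow_nonneg (hB i) _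
      calc ‖c i‖ ^ q ≤ B i ^ q := Real.rpow_le_rpow (norm_nonneg _) (hc i) hq0.le
        _ = (B i ^ p) ^ (1 + (q - p) / p) := by
            rw [← Real.rpow_mul (hB i)]; congr 1; field_simp; ring
        _ = B i ^ p * (B i ^ p) ^ ((q - p) / p) := by
            rw [Real.rpow_add_of_nonneg hBp zero_le_one (div_nonneg (by linarith) hp0.le),
              Real.rpow_one]
        _ ≤ B i ^ p * D := mul_le_mul_of_nonneg_left
            (Real.rpow_le_rpow hBp (hS i hi) (div_nonneg (by linarith) hp0.le)) hBp
  have hsum : ∑' i, ‖(c - restr c S) i‖ₑ ^ q ≤ ENNReal.ofReal (A * D) := by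
    calc _ ≤ ∑' i, ENNReal.ofReal (B i ^ p * D) := ENNReal.tsum_le_tsum hterm
      _ = ENNReal.ofReal (∑' i, B i ^ p * D) :=
          (ENNReal.ofReal_tsum_of_nonneg
            (fun i => mul_nonneg (Real.rpow_nonneg (hB i) _) hD0) (hs.mul_right D)).symm
      _ ≤ ENNReal.ofReal (A * D) := by
          refine ENNReal.ofReal_le_ofReal ?_
          rw [tsum_mul_right]
          exact mul_le_mul_of_nonneg_right (by linarith) hD0
  rw [ellNorm]
  calc _ ≤ ENNReal.ofReal (A * D) ^ (1 / q) := ENNReal.rpow_le_rpow hsum (by positivity)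
    _ = ENNReal.ofReal ((A * D) ^ (1 / q)) :=
        ENNReal.ofReal_rpow_of_nonneg (mul_nonneg hA0.le hD0) (by positivity)
    _ = _ := by
        congr 1
        rw [hD, Real.div_rpow hA0.le hs0.le, ← mul_div_assoc, Real.div_rpow (by positivity)
          (by positivity), ← Real.rpow_one_add' hA0.le, ← Real.rpow_mul hA0.le,
          ← Real.rpow_mul hs0.le, div_eq_mul_inv, ← Real.rpow_neg hs0.le]
        · congr 2 <;> field_simp <;> ring
        · have : 0 ≤ (q - p) / p := div_nonneg (by linarith) hp0.le
          positivity

lemma bestTermError_le {I V : Type*} [NormedAddCommGroup V] {s : ℕ} {q : ℝ} (hq : 0 < q)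
    (c : I → V) {S : Finset I} (hS : S.card ≤ s) :
    bestTermError s q c ≤ ellNorm q (c - restr c S) := by
  refine iInf₂_le (restr c S) ⟨?_, ?_⟩
  · have h0 : ∀ i ∉ S, ‖restr c S i‖ₑ ^ q = 0 := fun i hi => by simp [restr, hi, hq]
    rw [ellNorm, tsum_eq_sum h0]
    refine ENNReal.rpow_lt_top_of_nonneg (by positivity) (ENNReal.sum_lt_top.2 fun i _ => ?_).ne
    exact ENNReal.rpow_lt_top_of_nonneg hq.le enorm_ne_top
  · calc (Function.support (restr c S)).encard ≤ (S : Set I).encard :=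
          Set.encard_le_encard Set.support_indicator_subset
      _ = S.card := Set.encard_coe_eq_coe_finsetCard S
      _ ≤ s := by exact_mod_cast hS

/-! ### Orthonormality and completeness of the tensor product Legendre polynomials -/

lemma integral_Psi_mul_Psi (ν μ : ℕ →₀ ℕ) :
    ∫ y, Psi ν y * Psi μ y ∂unifDom = if ν = μ then 1 else 0 := by
  obtain ⟨m, hm⟩ := (ν.support ∪ μ.support).exists_nat_subset_range
  have hν := Finset.union_subset_left hm
  have hμ := Finset.union_subset_right hm
  have hemb : MeasurableEmbedding (Subtype.val : Set.Icc (-1 : ℝ) 1 → ℝ) :=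
    MeasurableEmbedding.subtype_coe measurableSet_Icc
  have : ∀ _ : Fin m, IsProbabilityMeasure (unif.map (Subtype.val : Set.Icc (-1 : ℝ) 1 → ℝ)) :=
    fun _ => Measure.isProbabilityMeasure_map measurable_subtype_coe.aemeasurable
  have hcont : Continuous fun s : Fin m → ℝ => ∏ i : Fin m, (psi (ν i) (s i) * psi (μ i) (s i)) := by
    refine continuous_finsetProd _ fun i _ => ?_
    have h1 := continuous_psi (ν i)
    have h2 := continuous_psi (μ i)
    fun_prop
  calc ∫ y, Psi ν y * Psi μ y ∂unifDom
      = ∫ y, (fun s : Fin m → ℝ => ∏ i : Fin m, (psi (ν i) (s i) * psi (μ i) (s i)))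
          (initial m y) ∂unifDom := by
        simp only [Psi_eq_prod hν, Psi_eq_prod hμ, ← Finset.prod_mul_distrib, initial]
    _ = ∫ s, ∏ i : Fin m, (psi (ν i) (s i) * psi (μ i) (s i))
          ∂Measure.pi fun _ : Fin m => unif.map Subtype.val := by
        rw [← map_initial, integral_map (measurable_initial m).aemeasurable
          hcont.aestronglyMeasurable]
    _ = ∏ i : Fin m, ∫ s, psi (ν i) s * psi (μ i) s ∂unif.map Subtype.val :=
        integral_fintype_prod_eq_prod (𝕜 := ℝ) fun (i : Fin m) s => psi (ν i) s * psi (μ i) s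
    _ = ∏ i : Fin m, if ν i = μ i then 1 else 0 := by
        refine Finset.prod_congr rfl fun i _ => ?_
        rw [hemb.integral_map, integral_psi_mul_psi]
    _ = if ν = μ then 1 else 0 := by
        split_ifs with h
        · simp [h]
        · obtain ⟨j, hj⟩ : ∃ j, ν j ≠ μ j := by
            by_contra hne
            push Not at hne
            exact h (Finsupp.ext hne)
          have hjm : j < m := by
            by_contra hjm
            have e1 : ν j = 0 := Finsupp.notMem_support_iff.1
              fun h => hjm (Finset.mem_range.1 (hν h))
            have e2 : μ j = 0 := Finsupp.notMem_support_iff.1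
              fun h => hjm (Finset.mem_range.1 (hμ h))
            exact hj (e1.trans e2.symm)
          exact Finset.prod_eq_zero (Finset.mem_univ ⟨j, hjm⟩) (if_neg hj)

/-- `Psi ν` as a continuous function. -/
def PsiMap (ν : ℕ →₀ ℕ) : C(Dom, ℝ) := ⟨Psi ν, continuous_Psi ν⟩

/-- The coordinates as continuous functions. -/
def coordMap (j : ℕ) : C(Dom, ℝ) := ⟨fun y => y j, by fun_prop⟩

lemma Psi_eq_prod_of_subset {ν : ℕ →₀ ℕ} {s : Finset ℕ} (hs : ν.support ⊆ s) (y : Dom) :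
    Psi ν y = ∏ i ∈ s, psi (ν i) (y i) :=
  Finset.prod_subset hs fun i _ hi => by rw [Finsupp.notMem_support_iff.1 hi, psi_zero]

lemma Psi_update (ν : ℕ →₀ ℕ) (j k : ℕ) (y : Dom) :
    Psi (ν.update j k) y = psi k (y j) * ∏ i ∈ ν.support.erase j, psi (ν i) (y i) := by
  classical
  have hs : (ν.update j k).support ⊆ insert j (ν.support.erase j) := by
    intro i hi
    by_cases hij : i = j
    · simp [hij]
    · simpa [hij] using hi
  rw [Psi_eq_prod_of_subset hs, Finset.prod_insert (Finset.notMem_erase j _)]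
  congr 1
  · simp
  · refine Finset.prod_congr rfl fun i hi => ?_
    simp [Finset.ne_of_mem_erase hi]

/-- Multiplication by `y_j` changes only the `j`-th factor, and the polynomial `t * psi (ν j) t` is
a combination of the `psi k`. -/
lemma coordMap_mul_PsiMap_mem (j : ℕ) (ν : ℕ →₀ ℕ) :
    coordMap j * PsiMap ν ∈ Submodule.span ℝ (Set.range PsiMap) := by
  obtain ⟨N, a, ha⟩ := exists_eval_eq_sum_psi
    (Polynomial.X * (Polynomial.C (Real.sqrt (2 * (ν j : ℝ) + 1)) * legendreP (ν j)))
  have e : coordMap j * PsiMap ν = ∑ k ∈ N, a k • PsiMap (ν.update j k) := by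
    ext y
    have h1 := ha (y j)
    simp only [Polynomial.eval_mul, Polynomial.eval_X, Polynomial.eval_C] at h1
    have h2 : Psi ν y = psi (ν j) (y j) * ∏ i ∈ ν.support.erase j, psi (ν i) (y i) := by
      rw [← Psi_update, Finsupp.update_self]
    simp only [ContinuousMap.mul_apply, ContinuousMap.coe_sum, Finset.sum_apply,
      ContinuousMap.smul_apply, smul_eq_mul]
    change (y j : ℝ) * Psi ν y = ∑ k ∈ N, a k * Psi (ν.update j k) y
    simp only [Psi_update, ← mul_assoc, ← Finset.sum_mul]
    rw [h2, ← h1, psi]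
    ring
  rw [e]
  exact Submodule.sum_mem _ fun k _ => Submodule.smul_mem _ _ (Submodule.subset_span ⟨_, rfl⟩)

/-- The functions that multiply the span into itself form an algebra containing the coordinates;
applying such a function to `1 = Psi 0` puts it in the span. -/
lemma adjoin_coordMap_le {h : C(Dom, ℝ)} (hh : h ∈ Algebra.adjoin ℝ (Set.range coordMap)) :
    h ∈ Submodule.span ℝ (Set.range PsiMap) := by
  have hmul : ∀ g ∈ Submodule.span ℝ (Set.range PsiMap),
      h * g ∈ Submodule.span ℝ (Set.range PsiMap) := by
    induction hh using Algebra.adjoin_induction with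
    | mem x hx =>
      obtain ⟨j, rfl⟩ := hx
      intro g hg
      induction hg using Submodule.span_induction with
      | mem x hx => obtain ⟨ν, rfl⟩ := hx; exact coordMap_mul_PsiMap_mem j ν
      | zero => simp
      | add x y _ _ hx hy => rw [mul_add]; exact Submodule.add_mem _ hx hy
      | smul a x _ hx => rw [mul_smul_comm]; exact Submodule.smul_mem _ _ hx
    | algebraMap r =>
      intro g hg
      rw [← Algebra.smul_def]
      exact Submodule.smul_mem _ _ hg
    | add x y _ _ hx hy =>
      intro g hg; rw [add_mul]; exact Submodule.add_mem _ (hx g hg) (hy g hg)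
    | mul x y _ _ hx hy =>
      intro g hg; rw [mul_assoc]; exact hx _ (hy g hg)
  have h1 : (1 : C(Dom, ℝ)) = PsiMap 0 := by
    ext y; simp [PsiMap, Psi]
  simpa using hmul 1 (h1 ▸ Submodule.subset_span ⟨0, rfl⟩)

/-- Stone–Weierstrass: the coordinates separate the points of the compact domain. -/
lemma dense_span_PsiMap : Dense (Submodule.span ℝ (Set.range PsiMap) : Set C(Dom, ℝ)) := by
  have hsep : (Algebra.adjoin ℝ (Set.range coordMap)).SeparatesPoints := by
    intro x y hxy
    obtain ⟨j, hj⟩ := Function.ne_iff.1 hxy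
    exact ⟨coordMap j, ⟨coordMap j, Algebra.subset_adjoin ⟨j, rfl⟩, rfl⟩,
      fun h => hj (Subtype.ext h)⟩
  have h1 := ContinuousMap.subalgebra_topologicalClosure_eq_top_of_separatesPoints _ hsep
  have h2 : Dense (Algebra.adjoin ℝ (Set.range coordMap) : Set C(Dom, ℝ)) := by
    rw [dense_iff_closure_eq, ← Subalgebra.topologicalClosure_coe, h1]
    rfl
  exact h2.mono fun h hh => adjoin_coordMap_le hh

lemma exists_polynomial_eLpNorm_sub_le {φ : Dom → ℝ} (hφ : MemLp φ 2 unifDom) {ε : ℝ≥0∞}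
    (hε : ε ≠ 0) :
    ∃ (T : Finset (ℕ →₀ ℕ)) (a : (ℕ →₀ ℕ) → ℝ),
      eLpNorm (fun y => ∑ ν ∈ T, a ν * Psi ν y - φ y) 2 unifDom ≤ ε := by
  have hd : Dense ((ContinuousMap.toLp 2 unifDom ℝ : C(Dom, ℝ) →L[ℝ] Lp ℝ 2 unifDom) ''
      (Submodule.span ℝ (Set.range PsiMap) : Set C(Dom, ℝ))) :=
    (ContinuousMap.toLp_denseRange ℝ unifDom ℝ (by norm_num)).dense_image
      (ContinuousMap.toLp 2 unifDom ℝ).continuous dense_span_PsiMap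
  obtain ⟨_, hx, h, hh, rfl⟩ := hd.inter_open_nonempty (Metric.eball (hφ.toLp φ) ε)
    Metric.isOpen_eball ⟨_, Metric.mem_eball_self (pos_iff_ne_zero.2 hε)⟩
  obtain ⟨c, hc⟩ := Finsupp.mem_span_range_iff_exists_finsupp.1 hh
  refine ⟨c.support, c, ?_⟩
  rw [Metric.mem_eball, Lp.edist_def] at hx
  refine le_trans (le_of_eq (eLpNorm_congr_ae ?_)) hx.le
  filter_upwards [ContinuousMap.coeFn_toLp (p := 2) (𝕜 := ℝ) unifDom h, hφ.coeFn_toLp] with y h1 h2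
  rw [Pi.sub_apply, h1, h2, ← hc, Finsupp.sum]
  simp [PsiMap]

/-! ### Parseval's inequality -/

section Parseval

variable {V : Type*} [NormedAddCommGroup V] [InnerProductSpace ℝ V]

/-- Vector valued polynomials in the basis `Psi`. -/
def polyFun (T : Finset (ℕ →₀ ℕ)) (v : (ℕ →₀ ℕ) → V) (y : Dom) : V := ∑ ν ∈ T, Psi ν y • v ν

lemma continuous_polyFun (T : Finset (ℕ →₀ ℕ)) (v : (ℕ →₀ ℕ) → V) : Continuous (polyFun T v) :=
  continuous_finsetSum _ fun ν _ => (continuous_Psi ν).smul continuous_const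

lemma memLp_polyFun (T : Finset (ℕ →₀ ℕ)) (v : (ℕ →₀ ℕ) → V) (p : ℝ≥0∞) :
    MemLp (polyFun T v) p unifDom :=
  (continuous_polyFun T v).memLp_of_hasCompactSupport (HasCompactSupport.of_compactSpace _)

lemma polyFun_eq_of_subset {T T' : Finset (ℕ →₀ ℕ)} (h : T ⊆ T') (v : (ℕ →₀ ℕ) → V) :
    polyFun T v = polyFun T' ((T : Set (ℕ →₀ ℕ)).indicator v) := by
  ext y
  unfold polyFun
  refine (Finset.sum_congr rfl fun ν hν => ?_).trans (Finset.sum_subset h fun ν _ hν => ?_)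
  · rw [Set.indicator_of_mem (by simpa using hν)]
  · rw [Set.indicator_of_notMem (by simpa using hν), smul_zero]

lemma polyFun_sub (T : Finset (ℕ →₀ ℕ)) (v w : (ℕ →₀ ℕ) → V) (y : Dom) :
    polyFun T v y - polyFun T w y = polyFun T (v - w) y := by
  simp [polyFun, smul_sub]

lemma exists_polyFun_eLpNorm_sub_le {f : Dom → V} (hf : MemLp f 2 unifDom) {ε : ℝ≥0∞}
    (hε : ε ≠ 0) :
    ∃ (T : Finset (ℕ →₀ ℕ)) (v : (ℕ →₀ ℕ) → V), eLpNorm (f - polyFun T v) 2 unifDom ≤ ε := by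
  classical
  -- Density reduces the claim to `1_s • c`, where a scalar approximation of the indicator is
  -- multiplied by `c`.
  have key := hf.induction_dense (by norm_num) (fun g => ∃ T v, g = polyFun T v) ?_ ?_ ?_ hε
  · obtain ⟨g, hg, T, v, rfl⟩ := key
    exact ⟨T, v, hg⟩
  · intro c s hs _ δ hδ
    have hφ : MemLp (s.indicator fun _ => (1 : ℝ)) 2 unifDom :=
      memLp_indicator_const 2 hs 1 (Or.inr (measure_ne_top _ _))
    obtain ⟨η, hη0, hη⟩ : ∃ η : ℝ≥0∞, η ≠ 0 ∧ ‖c‖₊ • η ≤ δ := by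
      have htop : (‖c‖₊ : ℝ≥0∞) + 1 ≠ ∞ := by simp
      refine ⟨δ / (‖c‖₊ + 1), ENNReal.div_ne_zero.2 ⟨hδ, htop⟩, ?_⟩
      rw [ENNReal.smul_def, smul_eq_mul]
      calc (‖c‖₊ : ℝ≥0∞) * (δ / (‖c‖₊ + 1)) ≤ (‖c‖₊ + 1) * (δ / (‖c‖₊ + 1)) := by
            gcongr; exact le_self_add
        _ = δ := ENNReal.mul_div_cancel (by simp) htop
    obtain ⟨T, a, ha⟩ := exists_polynomial_eLpNorm_sub_le hφ hη0
    refine ⟨_, ?_, T, fun ν => a ν • c, rfl⟩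
    have e : polyFun T (fun ν => a ν • c) - s.indicator (fun _ => c) =
        fun y => (∑ ν ∈ T, a ν * Psi ν y - s.indicator (fun _ => (1 : ℝ)) y) • c := by
      ext y
      rw [Pi.sub_apply, sub_smul, Finset.sum_smul, polyFun]
      congr 1
      · exact Finset.sum_congr rfl fun ν _ => by rw [smul_smul, mul_comm]
      · by_cases hy : y ∈ s <;> simp [hy]
    rw [e]
    refine le_trans (eLpNorm_le_nnreal_smul_eLpNorm_of_ae_le_mul (ae_of_all _ fun y => ?_) 2)
      (le_trans (by gcongr) hη)
    rw [nnnorm_smul, mul_comm]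
  · rintro _ _ ⟨T, v, rfl⟩ ⟨T', v', rfl⟩
    refine ⟨T ∪ T', (T : Set (ℕ →₀ ℕ)).indicator v + (T' : Set (ℕ →₀ ℕ)).indicator v', ?_⟩
    rw [polyFun_eq_of_subset (Finset.subset_union_left (s₂ := T')) v,
      polyFun_eq_of_subset (Finset.subset_union_right (s₁ := T)) v']
    ext y
    simp only [Pi.add_apply, polyFun, ← Finset.sum_add_distrib, ← smul_add]
  · rintro _ ⟨T, v, rfl⟩
    exact (continuous_polyFun T v).aestronglyMeasurable

lemma eLpNorm_two_eq {E : Type*} [NormedAddCommGroup E] {f : Dom → E} (hf : MemLp f 2 unifDom) :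
    eLpNorm f 2 unifDom = ENNReal.ofReal (Real.sqrt (∫ y, ‖f y‖ ^ 2 ∂unifDom)) := by
  rw [hf.eLpNorm_eq_integral_rpow_norm (by norm_num) (by norm_num), Real.sqrt_eq_rpow]
  norm_num

lemma integrable_Psi_smul {f : Dom → V} (hf : MemLp f 2 unifDom) (ν : ℕ →₀ ℕ) :
    Integrable (fun y => Psi ν y • f y) unifDom := by
  obtain ⟨C, hC⟩ := isCompact_univ.exists_bound_of_continuousOn (continuous_Psi ν).continuousOn
  exact (hf.integrable (by norm_num)).bdd_smul C (continuous_Psi ν).aestronglyMeasurable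
    (ae_of_all _ fun y => hC y trivial)

lemma inner_polyFun (f : Dom → V) (T : Finset (ℕ →₀ ℕ)) (v : (ℕ →₀ ℕ) → V) (y : Dom) :
    inner ℝ (f y) (polyFun T v y) = ∑ ν ∈ T, inner ℝ (v ν) (Psi ν y • f y) := by
  rw [polyFun, inner_sum]
  refine Finset.sum_congr rfl fun ν _ => ?_
  rw [inner_smul_right, inner_smul_right, real_inner_comm]

lemma integrable_inner_polyFun {f : Dom → V} (hf : MemLp f 2 unifDom)
    (T : Finset (ℕ →₀ ℕ)) (v : (ℕ →₀ ℕ) → V) :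
    Integrable (fun y => inner ℝ (f y) (polyFun T v y)) unifDom := by
  simp only [inner_polyFun]
  exact integrable_finsetSum _ fun ν _ => (integrable_Psi_smul hf ν).const_inner _

lemma integral_inner_polyFun [CompleteSpace V] {f : Dom → V} (hf : MemLp f 2 unifDom)
    (T : Finset (ℕ →₀ ℕ)) (v : (ℕ →₀ ℕ) → V) :
    ∫ y, inner ℝ (f y) (polyFun T v y) ∂unifDom = ∑ ν ∈ T, inner ℝ (coeff f ν) (v ν) := by
  simp only [inner_polyFun]
  rw [integral_finsetSum _ fun ν _ => (integrable_Psi_smul hf ν).const_inner _]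
  refine Finset.sum_congr rfl fun ν _ => ?_
  rw [integral_inner (integrable_Psi_smul hf ν), real_inner_comm, coeff]

lemma coeff_polyFun [CompleteSpace V] (T : Finset (ℕ →₀ ℕ)) (v : (ℕ →₀ ℕ) → V) {ν : ℕ →₀ ℕ}
    (hν : ν ∈ T) : coeff (polyFun T v) ν = v ν := by
  have e : ∀ y, Psi ν y • polyFun T v y = ∑ μ ∈ T, (Psi ν y * Psi μ y) • v μ := by
    intro y
    rw [polyFun, Finset.smul_sum]
    exact Finset.sum_congr rfl fun μ _ => smul_smul _ _ _
  have hi (μ : ℕ →₀ ℕ) : Integrable (fun y => (Psi ν y * Psi μ y) • v μ) unifDom := by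
    refine Integrable.smul_const ?_ _
    have hc : Continuous fun y => Psi ν y * Psi μ y := (continuous_Psi ν).mul (continuous_Psi μ)
    exact hc.integrable_of_hasCompactSupport (HasCompactSupport.of_compactSpace _)
  simp only [coeff, e]
  rw [integral_finsetSum _ fun μ _ => hi μ]
  simp only [integral_smul_const, integral_Psi_mul_Psi]
  simp [hν]

lemma coeff_sub {f g : Dom → V} (hf : MemLp f 2 unifDom) (hg : MemLp g 2 unifDom)
    (ν : ℕ →₀ ℕ) : coeff (fun y => f y - g y) ν = coeff f ν - coeff g ν := by
  simp only [coeff, smul_sub]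
  exact integral_sub (integrable_Psi_smul hf ν) (integrable_Psi_smul hg ν)

lemma integral_norm_polyFun_sq [CompleteSpace V] (T : Finset (ℕ →₀ ℕ)) (v : (ℕ →₀ ℕ) → V) :
    ∫ y, ‖polyFun T v y‖ ^ 2 ∂unifDom = ∑ ν ∈ T, ‖v ν‖ ^ 2 := by
  simp only [← real_inner_self_eq_norm_sq]
  rw [integral_inner_polyFun (memLp_polyFun T v 2)]
  exact Finset.sum_congr rfl fun ν hν => by rw [coeff_polyFun T v hν]

lemma partialSum_eq (f : Dom → V) (S : Finset (ℕ →₀ ℕ)) :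
    partialSum f S = polyFun S (coeff f) := rfl

/-- The truncated expansion is the best approximation from its span. -/
lemma eLpNorm_sub_partialSum_le [CompleteSpace V] {f : Dom → V} (hf : MemLp f 2 unifDom)
    (T : Finset (ℕ →₀ ℕ)) (v : (ℕ →₀ ℕ) → V) :
    eLpNorm (fun y => f y - partialSum f T y) 2 unifDom ≤
      eLpNorm (fun y => f y - polyFun T v y) 2 unifDom := by
  have hr : MemLp (fun y => f y - partialSum f T y) 2 unifDom := hf.sub (memLp_polyFun T _ 2)
  have hw : MemLp (polyFun T (coeff f - v)) 2 unifDom := memLp_polyFun _ _ 2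
  have hg : MemLp (fun y => f y - polyFun T v y) 2 unifDom := hf.sub (memLp_polyFun T _ 2)
  rw [eLpNorm_two_eq hr, eLpNorm_two_eq hg]
  refine ENNReal.ofReal_le_ofReal (Real.sqrt_le_sqrt ?_)
  have hexp : ∀ y, ‖f y - polyFun T v y‖ ^ 2 = ‖f y - partialSum f T y‖ ^ 2 +
      2 * inner ℝ (f y - partialSum f T y) (polyFun T (coeff f - v) y) +
        ‖polyFun T (coeff f - v) y‖ ^ 2 := by
    intro y
    rw [← norm_add_sq_real, ← polyFun_sub, partialSum_eq]
    congr 2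
    abel
  -- The residual has vanishing coefficients on `T`, so it is orthogonal to every polynomial over
  -- `T`, and Pythagoras applies.
  have hcross : ∫ y, inner ℝ (f y - partialSum f T y) (polyFun T (coeff f - v) y) ∂unifDom = 0 := by
    rw [integral_inner_polyFun hr]
    refine Finset.sum_eq_zero fun ν hν => ?_
    rw [partialSum_eq, coeff_sub hf (memLp_polyFun T _ 2), coeff_polyFun T _ hν, sub_self,
      inner_zero_left]
  have hi : Integrable (fun y => inner ℝ (f y - partialSum f T y) (polyFun T (coeff f - v) y))
      unifDom := integrable_inner_polyFun hr T _
  simp only [hexp]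
  have hr2 := hr.integrable_norm_pow (by norm_num)
  have hw2 := hw.integrable_norm_pow (by norm_num)
  have hri : Integrable (fun y => ‖f y - partialSum f T y‖ ^ 2 +
      2 * inner ℝ (f y - partialSum f T y) (polyFun T (coeff f - v) y)) unifDom :=
    hr2.add (hi.const_mul 2)
  rw [integral_add hri hw2, integral_add hr2 (hi.const_mul 2),
    integral_const_mul, hcross]
  have : 0 ≤ ∫ y, ‖polyFun T (coeff f - v) y‖ ^ 2 ∂unifDom :=
    integral_nonneg fun y => by positivity
  linarith

lemma eLpNorm_polyFun_le [CompleteSpace V] (T : Finset (ℕ →₀ ℕ)) (v : (ℕ →₀ ℕ) → V) :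
    eLpNorm (polyFun T v) 2 unifDom ≤ ellNorm 2 v := by
  rw [eLpNorm_two_eq (memLp_polyFun T v 2), integral_norm_polyFun_sq, ellNorm,
    Real.sqrt_eq_rpow, ← ENNReal.ofReal_rpow_of_nonneg (Finset.sum_nonneg fun _ _ => by positivity)
    (by norm_num)]
  refine ENNReal.rpow_le_rpow ?_ (by norm_num)
  rw [ENNReal.ofReal_sum_of_nonneg fun _ _ => by positivity]
  refine le_trans (Finset.sum_le_sum fun ν _ => le_of_eq ?_) (ENNReal.sum_le_tsum T)
  rw [ENNReal.ofReal_pow (norm_nonneg _), ofReal_norm]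
  norm_num

/-- The `L²` error of a truncated expansion is bounded by the `ℓ²` norm of the other
coefficients. -/
lemma eLpNorm_sub_partialSum_le_ellNorm [CompleteSpace V] {f : Dom → V} (hf : MemLp f 2 unifDom)
    (S : Finset (ℕ →₀ ℕ)) :
    eLpNorm (fun y => f y - partialSum f S y) 2 unifDom ≤
      ellNorm 2 (coeff f - restr (coeff f) S) := by
  classical
  refine ENNReal.le_of_forall_pos_le_add fun ε hε _ => ?_
  obtain ⟨T, v, hT⟩ := exists_polyFun_eLpNorm_sub_le hf
    (ε := (ε : ℝ≥0∞)) (by exact_mod_cast hε.ne')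
  -- On the union, the truncation is at least as good as the approximant over `T`. The rest of the
  -- error is a polynomial whose coefficients are those of `f` on `T` outside `S`, controlled by the
  -- `ℓ²` tail.
  have h1 : eLpNorm (fun y => f y - partialSum f (S ∪ T) y) 2 unifDom ≤ ε := by
    refine le_trans (eLpNorm_sub_partialSum_le hf (S ∪ T) ((T : Set (ℕ →₀ ℕ)).indicator v)) ?_
    rw [← polyFun_eq_of_subset Finset.subset_union_right]
    exact hT
  have h2 : ∀ y, f y - partialSum f S y = polyFun (S ∪ T) (coeff f - restr (coeff f) S) y +
      (f y - partialSum f (S ∪ T) y) := by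
    intro y
    rw [← polyFun_sub, partialSum_eq, partialSum_eq, restr,
      ← polyFun_eq_of_subset Finset.subset_union_left]
    abel
  simp only [h2]
  refine (eLpNorm_add_le (memLp_polyFun _ _ 2).aestronglyMeasurable
    (hf.sub (memLp_polyFun _ _ 2)).aestronglyMeasurable (by norm_num)).trans ?_
  exact add_le_add (eLpNorm_polyFun_le _ _) h1

end Parseval

/-! ### The approximation theorem -/

/-- Each weight equals `(ρ-1)^2 / (2ρ) ≥ 0`, so enlarging `b` only tightens the budget. -/
lemma region_anti {b b' : ℕ → ℝ} (hb : ∀ j, 0 ≤ b j) (h : ∀ j, b j ≤ b' j) :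
    region b' 1 ⊆ region b 1 := by
  rintro z ⟨ρ, hρ, hs, hle, hz⟩
  have hnn : ∀ j, 0 ≤ (ρ j + (ρ j)⁻¹) / 2 - 1 := by
    intro j
    have hj : 0 < ρ j := by linarith [hρ j]
    have : (ρ j + (ρ j)⁻¹) / 2 - 1 = (ρ j - 1) ^ 2 / (2 * ρ j) := by field_simp; ring
    rw [this]
    positivity
  have hmono : ∀ j, ((ρ j + (ρ j)⁻¹) / 2 - 1) * b j ≤ ((ρ j + (ρ j)⁻¹) / 2 - 1) * b' j :=
    fun j => mul_le_mul_of_nonneg_left (h j) (hnn j)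
  have hs' := hs.of_nonneg_of_le (fun j => mul_nonneg (hnn j) (hb j)) hmono
  exact ⟨ρ, hρ, hs', (hs'.tsum_le_tsum hmono hs).trans hle, hz⟩

lemma holoClass_mono {V W : Type*} [NormedAddCommGroup V] [NormedSpace ℝ V]
    [NormedAddCommGroup W] [NormedSpace ℂ W] (ι : V →ₗᵢ[ℝ] W) {b b' : ℕ → ℝ}
    (hb : ∀ j, 0 ≤ b j) (h : ∀ j, b j ≤ b' j) : holoClass ι b ⊆ holoClass ι b' := by
  rintro f ⟨O, g, hO, hsub, hg, hfg, hle⟩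
  exact ⟨O, g, hO, (region_anti hb h).trans hsub, hg, hfg,
    fun z hz => hle z (region_anti hb h hz)⟩

/-- Each `p`-summable sequence is dominated by a positive one. -/
lemma exists_pos_majorant {b : ℕ → ℝ} (hb : ∀ j, 0 ≤ b j) {p : ℝ} (hp0 : 0 < p)
    (hbp : Memℓp b (ENNReal.ofReal p)) :
    ∃ b' : ℕ → ℝ, (∀ j, 0 < b' j) ∧ (∀ j, b j ≤ b' j) ∧ Summable fun j => b' j ^ p := by
  have hp : 0 < (ENNReal.ofReal p).toReal := by rwa [ENNReal.toReal_ofReal hp0.le]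
  have hg : Memℓp (fun j : ℕ => ((1 / 2 : ℝ) ^ j)) (ENNReal.ofReal p) := by
    refine (memℓp_gen_iff hp).2 ?_
    have h1 : ((1 / 2 : ℝ)) ^ p < 1 := Real.rpow_lt_one (by norm_num) (by norm_num) hp0
    refine (summable_geometric_of_lt_one (by positivity) h1).congr fun j => ?_
    rw [ENNReal.toReal_ofReal hp0.le, Real.norm_of_nonneg (by positivity),
      Real.rpow_pow_comm (by norm_num)]
  have hpos : ∀ j : ℕ, (0 : ℝ) < (1 / 2) ^ j := fun j => by positivity
  -- Strict positivity is required because the radii divide by `b j`.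
  refine ⟨fun j => b j + (1 / 2) ^ j, fun j => add_pos_of_nonneg_of_pos (hb j) (hpos j),
    fun j => le_add_of_nonneg_right (hpos j).le, ?_⟩
  refine ((memℓp_gen_iff hp).1 (hbp.add hg)).congr fun j => ?_
  rw [ENNReal.toReal_ofReal hp0.le, Pi.add_apply,
    Real.norm_of_nonneg (add_nonneg (hb j) (hpos j).le)]

end

end HoloApprox

theorem theoremt (b : ℕ → ℝ) (hb : ∀ j, 0 ≤ b j) (p : ℝ) (hp0 : 0 < p) (hp1 : p < 1)
    (hbp : Memℓp b (ENNReal.ofReal p)) :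
    ∃ C : ℝ, 0 < C ∧
      (∀ (s : ℕ) (q : ℝ), 1 ≤ s → p ≤ q → q ≤ 2 →
        ∃ S : Finset (ℕ →₀ ℕ), S.card ≤ s ∧
          ∀ (V : Type*) [NormedAddCommGroup V] [NormedSpace ℝ V] [CompleteSpace V]
            (W : Type*) [NormedAddCommGroup W] [NormedSpace ℂ W] [CompleteSpace W]
            (ι : V →ₗᵢ[ℝ] W) (f : HoloApprox.Dom → V),
            f ∈ HoloApprox.holoClass ι b → AEStronglyMeasurable f HoloApprox.unifDom →
            HoloApprox.bestTermError s q (HoloApprox.coeff f) ≤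
                HoloApprox.ellNorm q
                  (HoloApprox.coeff f - HoloApprox.restr (HoloApprox.coeff f) S) ∧
              HoloApprox.ellNorm q
                  (HoloApprox.coeff f - HoloApprox.restr (HoloApprox.coeff f) S) ≤
                ENNReal.ofReal (C * (s : ℝ) ^ (1 / q - 1 / p))) ∧
      (∀ s : ℕ, 1 ≤ s →
        ∃ S : Finset (ℕ →₀ ℕ), S.card ≤ s ∧
          ∀ (V : Type*) [NormedAddCommGroup V] [InnerProductSpace ℝ V] [CompleteSpace V]
            (W : Type*) [NormedAddCommGroup W] [NormedSpace ℂ W] [CompleteSpace W]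
            (ι : V →ₗᵢ[ℝ] W) (f : HoloApprox.Dom → V),
            f ∈ HoloApprox.holoClass ι b → AEStronglyMeasurable f HoloApprox.unifDom →
            HoloApprox.bestL2Error s f ≤
                eLpNorm (fun y => f y - HoloApprox.partialSum f S y) 2 HoloApprox.unifDom ∧
              eLpNorm (fun y => f y - HoloApprox.partialSum f S y) 2 HoloApprox.unifDom ≤
                ENNReal.ofReal (C * (s : ℝ) ^ (1 / 2 - 1 / p))) := by
  obtain ⟨b', hb'0, hbb', hb's⟩ := HoloApprox.exists_pos_majorant hb hp0 hbp
  obtain ⟨B, hBs, hB⟩ := HoloApprox.exists_coeff_bound hb'0 hp0 hp1 hb's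
  have hB0 : ∀ ν, 0 ≤ B ν := fun ν => (hB ν).1
  have hA : 0 ≤ ∑' ν, B ν ^ p := tsum_nonneg fun ν => Real.rpow_nonneg (hB0 ν) _
  -- The bounds `B` come from `b` and `p` alone, so neither the constant nor the sets `S` depend on
  -- the spaces or on `f`.
  refine ⟨(1 + ∑' ν, B ν ^ p) ^ (1 / p), by positivity, fun s q hs hpq _ => ?_, fun s hs => ?_⟩
  · obtain ⟨S, hSc, hS⟩ := HoloApprox.exists_finset_small hB0 hBs hs
    refine ⟨S, hSc.le, fun V _ _ _ W _ _ _ ι f hf hm => ⟨?_, ?_⟩⟩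
    · exact HoloApprox.bestTermError_le (hp0.trans_le hpq) _ hSc.le
    · refine HoloApprox.ellNorm_sub_restr_le hp0 hB0 hBs hs hS (fun ν => ?_) hpq
      obtain ⟨-, ρ, h1, h2, h3, h4, h5⟩ := hB ν
      exact (HoloApprox.norm_coeff_le (HoloApprox.holoClass_mono ι hb hbb' hf) hm ν
        h1 h2 h3 h4).trans h5
  · obtain ⟨S, hSc, hS⟩ := HoloApprox.exists_finset_small hB0 hBs hs
    refine ⟨S, hSc.le, fun V _ _ _ W _ _ _ ι f hf hm => ⟨?_, ?_⟩⟩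
    · exact iInf₂_le S hSc
    · refine (HoloApprox.eLpNorm_sub_partialSum_le_ellNorm
        (HoloApprox.memLp_of_mem_holoClass hf hm 2) S).trans ?_
      refine HoloApprox.ellNorm_sub_restr_le hp0 hB0 hBs hs hS (fun ν => ?_) (by linarith)
      obtain ⟨-, ρ, h1, h2, h3, h4, h5⟩ := hB ν
      exact (HoloApprox.norm_coeff_le (HoloApprox.holoClass_mono ι hb hbb' hf) hm ν
        h1 h2 h3 h4).trans h5
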